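/- Let $\nu$ be a measure on a measurable space $\mathcal X$, $h:\mathcal X\to[0,\infty)$ and $T:\mathcal X\to\mathbb R^k$ measurable, $A(\theta)=\log\int h\,e^{\langle\theta,T\rangle}\,d\nu$, and $\Theta=\{\theta\in\mathbb R^k:|A(\theta)|<\infty\}$. The full model $F$ is the canonical exponential family with $\nu$-densities $f(x\mid\theta)=h(x)\exp\{\langle\theta,T(x)\rangle-A(\theta)\}$, $\theta\in\Theta$, assumed to be of rank $k$ (no nontrivial linear combination of the components of $T$ is almost surely constant under a member of the family). Let $M\in\mathbb R^{\ell\times k}$ have rank $\ell<k$. The nested model $N$ has densities $f(x\mid M^\top\eta)$, with $\eta\in\mathcal E=\{\eta\in\mathbb R^\ell: M^\top\eta\in\Theta\}$ and log-partition function $B(\eta)=A(M^\top\eta)$; assume $\mathcal E\neq\emptyset$. Equip $F$ and $N$ with the conjugate priors $\rho_F(\theta)\propto\exp\{\langle\tau,\theta\rangle-mA(\theta)\}$ on $\Theta$ and $\rho_N(\eta)\propto\exp\{\langle\upsilon,\eta\rangle-wB(\eta)\}$ on $\mathcal E$, normalized to be probability densities with respect to Lebesgue measure. For observations $X_1,\dots,X_n$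 the evidences are $$E_F^{(n)}=\int_\Theta\prod_{i=1}^n f(X_i\mid\theta)\,\rho_F(\theta)\,d\theta,\qquad E_N^{(n)}=\int_{\mathcal E}\prod_{i=1}^n f(X_i\mid M^\top\eta)\,\rho_N(\eta)\,d\eta .$$ Suppose that $X_1,X_2,\dots$ are i.i.d. with density $f(\cdot\mid\theta_0)$ for some $\theta_0\in\Theta$, that $\Theta$ and $\mathcal E$ are open, that $m,w>0$, that $\tau/m$ lies in the interior of the convex support (the smallest closed convex set of probability one) of $T(X_1)$, and that $\upsilon/w$ lies in the interior of the convex support of $MT(X_1)$. Write $\dot A$, $\dot B$ for the gradients. (i) If $\theta_0\in\Theta\setminus M^\top(\mathcal E)$, then there is a unique $\tilde\eta_0\in\mathcal E$ with $\dot B(\tilde\eta_0)=M\dot A(\theta_0)$, and $$n^{-1}\log\frac{E_F^{(n)}}{E_N^{(n)}}\ \xrightarrow{\;p\;}\ \langle\theta_0-M^\top\tilde\eta_0,\dot A(\theta_0)\rangle-\bigl(A(\theta_0)-A(M^\top\tilde\eta_0)\bigr)>0 .$$ (ii) If $\theta_0\in M^\top(\mathcal E)$, then $$(\log n)^{-1}\log\frac{E_F^{(n)}}{E_N^{(n)}}\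 \xrightarrow{\;p\;}\ -\frac{k-\ell}{2}<0 .$$ -/

import Mathlib

open MeasureTheory ProbabilityTheory Filter Topology
open scoped ENNReal

/-- The data of a canonical exponential family with `k`-dimensional statistic: a dominating
measure `ν` on the sample space, a carrier density `h ≥ 0` and a natural sufficient
statistic `T`. -/
structure ExpFamily (𝒳 : Type*) [MeasurableSpace 𝒳] (k : ℕ) where
  ν : Measure 𝒳
  h : 𝒳 → ℝ
  h_nonneg : ∀ x, 0 ≤ h x
  measurable_h : Measurable h
  T : 𝒳 → EuclideanSpace ℝ (Fin k)
  measurable_T : Measurable T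

/-- The convex support of a measure: the smallest closed convex set of full measure. -/
def convexSupport {E : Type*} [NormedAddCommGroup E] [NormedSpace ℝ E] [MeasurableSpace E]
    (μ : Measure E) : Set E :=
  ⋂₀ {C : Set E | IsClosed C ∧ Convex ℝ C ∧ μ Cᶜ = 0}

namespace ExpFamily

variable {𝒳 : Type*} [MeasurableSpace 𝒳] {k : ℕ}

/-- `∫ h(x) exp⟨θ, T(x)⟩ dν(x)`. -/
noncomputable def partitionFn (F : ExpFamily 𝒳 k) (θ : EuclideanSpace ℝ (Fin k)) : ℝ :=
  ∫ x, F.h x * Real.exp (inner ℝ θ (F.T x)) ∂F.ν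

/-- The log-partition function `A`. -/
noncomputable def logPartition (F : ExpFamily 𝒳 k) (θ : EuclideanSpace ℝ (Fin k)) : ℝ :=
  Real.log (F.partitionFn θ)

/-- The natural parameter space `{θ : |A(θ)| < ∞}`: the partition integral is finite and
nonzero. -/
def naturalSpace (F : ExpFamily 𝒳 k) : Set (EuclideanSpace ℝ (Fin k)) :=
  {θ | Integrable (fun x => F.h x * Real.exp (inner ℝ θ (F.T x))) F.ν ∧ 0 < F.partitionFn θ}

/-- The density `f(x | θ) = h(x) exp(⟨θ, T(x)⟩ - A(θ))` with respect to `ν`. -/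
noncomputable def density (F : ExpFamily 𝒳 k) (θ : EuclideanSpace ℝ (Fin k)) (x : 𝒳) : ℝ :=
  F.h x * Real.exp (inner ℝ θ (F.T x) - F.logPartition θ)

/-- The distribution with density `f(· | θ)`. -/
noncomputable def law (F : ExpFamily 𝒳 k) (θ : EuclideanSpace ℝ (Fin k)) : Measure 𝒳 :=
  F.ν.withDensity fun x => ENNReal.ofReal (F.density θ x)

/-- The family has rank `k`: no nontrivial affine function of the statistic vanishes almost
everywhere under any member of the family. -/
def IsFullRank (F : ExpFamily 𝒳 k) : Prop :=
  ∀ θ ∈ F.naturalSpace, ∀ (c : EuclideanSpace ℝ (Fin k)) (b : ℝ),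
    (∀ᵐ x ∂(F.law θ), inner ℝ c (F.T x) = b) → c = 0

/-- The likelihood of the first `n` observations of the sequence `x`. -/
noncomputable def likelihood (F : ExpFamily 𝒳 k) (n : ℕ) (x : ℕ → 𝒳)
    (θ : EuclideanSpace ℝ (Fin k)) : ℝ :=
  ∏ i ∈ Finset.range n, F.density θ (x i)

/-- The normalizing constant of the conjugate prior with hyperparameters `τ`, `m`. -/
noncomputable def priorConst (F : ExpFamily 𝒳 k) (τ : EuclideanSpace ℝ (Fin k)) (m : ℝ) : ℝ :=
  (∫ θ in F.naturalSpace, Real.exp (inner ℝ τ θ - m * F.logPartition θ))⁻¹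

/-- The conjugate prior density with respect to Lebesgue measure on the natural parameter
space. -/
noncomputable def prior (F : ExpFamily 𝒳 k) (τ : EuclideanSpace ℝ (Fin k)) (m : ℝ)
    (θ : EuclideanSpace ℝ (Fin k)) : ℝ :=
  F.priorConst τ m * Real.exp (inner ℝ τ θ - m * F.logPartition θ)

/-- The evidence: the likelihood integrated against the conjugate prior. -/
noncomputable def evidence (F : ExpFamily 𝒳 k) (τ : EuclideanSpace ℝ (Fin k)) (m : ℝ)
    (n : ℕ) (x : ℕ → 𝒳) : ℝ :=
  ∫ θ in F.naturalSpace, F.likelihood n x θ * F.prior τ m θ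

variable {l : ℕ}

/-- The linearly nested submodel `θ = Mᵀ η`, as the exponential family with statistic `M T`.
Its log-partition function, parameter space and densities are those of `F` at `Mᵀ η`; see
the lemmas below. -/
noncomputable def nested (F : ExpFamily 𝒳 k) (M : Matrix (Fin l) (Fin k) ℝ) :
    ExpFamily 𝒳 l where
  ν := F.ν
  h := F.h
  h_nonneg := F.h_nonneg
  measurable_h := F.measurable_h
  T := fun x => M.toEuclideanLin (F.T x)
  measurable_T :=
    (LinearMap.continuous_of_finiteDimensional M.toEuclideanLin).measurable.comp F.measurable_T

theorem inner_nested_T (F : ExpFamily 𝒳 k) (M : Matrix (Fin l) (Fin k) ℝ)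
    (η : EuclideanSpace ℝ (Fin l)) (x : 𝒳) :
    inner ℝ η ((F.nested M).T x) = inner ℝ (M.transpose.toEuclideanLin η) (F.T x) := by
  have h : M.transpose.toEuclideanLin = LinearMap.adjoint M.toEuclideanLin := by
    rw [← Matrix.toEuclideanLin_conjTranspose_eq_adjoint, Matrix.conjTranspose_eq_transpose_of_trivial]
  rw [h, LinearMap.adjoint_inner_left]
  rfl

theorem logPartition_nested (F : ExpFamily 𝒳 k) (M : Matrix (Fin l) (Fin k) ℝ)
    (η : EuclideanSpace ℝ (Fin l)) :
    (F.nested M).logPartition η = F.logPartition (M.transpose.toEuclideanLin η) := by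
  unfold logPartition partitionFn
  simp only [inner_nested_T]
  rfl

theorem naturalSpace_nested (F : ExpFamily 𝒳 k) (M : Matrix (Fin l) (Fin k) ℝ) :
    (F.nested M).naturalSpace = {η | M.transpose.toEuclideanLin η ∈ F.naturalSpace} := by
  ext η
  simp only [naturalSpace, partitionFn, Set.mem_ofPred_eq, inner_nested_T]
  rfl

theorem density_nested (F : ExpFamily 𝒳 k) (M : Matrix (Fin l) (Fin k) ℝ)
    (η : EuclideanSpace ℝ (Fin l)) (x : 𝒳) :
    (F.nested M).density η x = F.density (M.transpose.toEuclideanLin η) x := by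
  unfold density
  rw [inner_nested_T, logPartition_nested]
  rfl

end ExpFamily

/-! By conjugacy the evidence is `∏ h(X i)` times a ratio of two conjugate masses, the one on top
having parameters `τ + s`, `m + n`, where `s` is the sum of the statistics. In the Bayes factor the
products cancel, so everything rests on a Laplace estimate with bounded error,
`exists_abs_log_conjugateMass_le`: the log mass is `⟨s, θ⟩ - n A(θ) - (d/2) log n + O(1)` uniformly
over `s` within `R √n` of `n` times the mean at `θ`. The centre `θ` is fixed, not a maximum
likelihood estimate, and no exact Gaussian limit is needed.

The estimate squeezes the Bregman divergence of `A`, whose exponential is an exponential moment of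
the centred statistic. The divergence is at most quadratic near `θ` (`exists_divergence_le`) and, by
full rank, at least a multiple of `min (t ^ 2) t` at every distance `t` (`exists_le_divergence`).
The prior exponent is bounded above because its normalized parameter is interior to the convex
support (`exists_linear_growth`).

The nested model is treated as a family with statistic `M T`, centred at the `η₀` whose mean is `M`
times the true mean. It exists because the divergence attains its minimum over the submodel
(`exists_mean_nested_eq`). Only this matching of means is used, so misspecification does no harm.
Subtracting the two estimates gives `exists_abs_log_evidence_ratio_le`. Off the submodel the linear
term dominates and tends, per observation, to a positive divergence; on it that term vanishes and
the dimension gap in `log n` remains. Chebyshev's inequality makes the restriction on `s` hold with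
probability arbitrarily close to one, uniformly in `n`. -/

section ExponentialMoments

/-! ### Bounds on exponential moments. -/

variable {𝒳 : Type*} [MeasurableSpace 𝒳] {ρ : Measure 𝒳}

theorem exp_le_one_add_add_sq_mul_exp_abs (y : ℝ) :
    Real.exp y ≤ 1 + y + y ^ 2 * Real.exp |y| := by
  have h1 := Real.add_one_le_exp (-y)
  have h2 : Real.exp y * Real.exp (-y) = 1 := by rw [← Real.exp_add]; simp
  have h3 := Real.exp_pos y
  have h4 : Real.exp y - 1 ≤ y * Real.exp y := by nlinarith
  rcases le_total 0 y with hy | hy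
  · rw [abs_of_nonneg hy]
    nlinarith
  · have h5 : 1 ≤ Real.exp |y| := Real.one_le_exp (abs_nonneg y)
    have h6 := Real.add_one_le_exp y
    nlinarith [mul_nonneg (neg_nonneg.2 hy) (sub_nonneg.2 h6),
      mul_nonneg (sq_nonneg y) (sub_nonneg.2 h5)]

theorem monotoneOn_exp_sub_id : MonotoneOn (fun x : ℝ => Real.exp x - x) (Set.Ici 0) := by
  intro x hx y _ hxy
  have h1 : (1 : ℝ) ≤ Real.exp x := Real.one_le_exp hx
  have h2 := Real.add_one_le_exp (y - x)
  have h3 : Real.exp y = Real.exp x * Real.exp (y - x) := by rw [← Real.exp_add]; ring_nf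
  simp only
  rw [h3]
  nlinarith [mul_nonneg (sub_nonneg.2 h1) (sub_nonneg.2 hxy)]

theorem integrable_exp_mul_norm_of_integrable_exp_inner {d : ℕ}
    {Z : 𝒳 → EuclideanSpace ℝ (Fin d)} (hZ : Measurable Z) {r : ℝ} (hr : 0 < r)
    [IsFiniteMeasure ρ]
    (h : ∀ v : EuclideanSpace ℝ (Fin d), ‖v‖ < r →
      Integrable (fun x => Real.exp (inner ℝ v (Z x))) ρ) :
    ∃ s > 0, Integrable (fun x => Real.exp (s * ‖Z x‖)) ρ := by
  set q : ℝ := r / 2 with hq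
  have hq0 : 0 < q := by positivity
  refine ⟨q / (d + 1), by positivity, ?_⟩
  have hint : ∀ (i : Fin d) (c : ℝ), |c| = q → Integrable (fun x => Real.exp (c * Z x i)) ρ := by
    intro i c hc
    have := h (EuclideanSpace.single i c) (by simp [hc, hq]; linarith)
    simpa [EuclideanSpace.inner_single_left] using this
  have hdom : Integrable (fun x => 1 + ∑ i : Fin d,
      (Real.exp (q * Z x i) + Real.exp (-q * Z x i))) ρ := by
    refine (integrable_const _).add (integrable_finsetSum _ fun i _ => ?_)
    exact (hint i q (abs_of_pos hq0)).add (hint i (-q) (by rw [abs_neg, abs_of_pos hq0]))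
  refine hdom.mono' (by fun_prop) (ae_of_all _ fun x => ?_)
  rw [Real.norm_of_nonneg (Real.exp_pos _).le]
  have hpos : ∀ j ∈ Finset.univ, 0 ≤ Real.exp (q * Z x j) + Real.exp (-q * Z x j) :=
    fun j _ => by positivity
  -- The norm is at most the sum of the `d` absolute coordinates, so if every coordinate is below
  -- `‖Z x‖ / (d + 1)` the norm is zero. Using `d + 1` also covers `d = 0`.
  by_cases hx : ∃ i, ‖Z x‖ ≤ (d + 1) * |Z x i|
  · obtain ⟨i, hi⟩ := hx
    have h1 : q / (d + 1) * ‖Z x‖ ≤ q * |Z x i| := by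
      rw [div_mul_eq_mul_div, div_le_iff₀ (by positivity)]
      nlinarith
    have h2 : Real.exp (q * |Z x i|) ≤ Real.exp (q * Z x i) + Real.exp (-q * Z x i) := by
      rcases abs_choice (Z x i) with h | h <;> rw [h]
      · linarith [Real.exp_pos (-q * Z x i)]
      · rw [mul_neg, ← neg_mul]; linarith [Real.exp_pos (q * Z x i)]
    have h3 := Finset.single_le_sum hpos (Finset.mem_univ i)
    linarith [Real.exp_le_exp.2 h1]
  · push Not at hx
    have h0 : ‖Z x‖ = 0 := by
      have h1 : ‖Z x‖ ≤ ∑ i, |Z x i| := by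
        rw [EuclideanSpace.norm_eq]
        refine Real.sqrt_le_iff.2 ⟨Finset.sum_nonneg fun _ _ => abs_nonneg _, ?_⟩
        simpa using Finset.sum_sq_le_sq_sum_of_nonneg (s := Finset.univ)
          (f := fun i => |Z x i|) fun _ _ => abs_nonneg _
      have h2 : ∑ i, |Z x i| ≤ ∑ _i : Fin d, ‖Z x‖ / (d + 1) := by
        refine Finset.sum_le_sum fun i _ => ?_
        rw [le_div_iff₀ (by positivity)]
        linarith [hx i]
      simp only [Finset.sum_const, Finset.card_univ, Fintype.card_fin, nsmul_eq_mul] at h2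
      have h3 : (d : ℝ) * (‖Z x‖ / (d + 1)) = ‖Z x‖ - ‖Z x‖ / (d + 1) := by field_simp; ring
      have h4 : ‖Z x‖ / (d + 1) ≤ 0 := by linarith
      have h5 := (div_le_iff₀ (by positivity : (0:ℝ) < d + 1)).1 h4
      linarith [norm_nonneg (Z x)]
    rw [h0, mul_zero, Real.exp_zero]
    linarith [Finset.sum_nonneg hpos]

variable {E : Type*} [NormedAddCommGroup E] [InnerProductSpace ℝ E]

/-- Let `g v` be the mean positive part of `⟨v, Z⟩`. A centred variable whose positive part has mean
zero vanishes almost surely, so nondegeneracy and compactness of the sphere give `g v ≥ a ‖v‖`.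
Jensen's inequality for the positive part then yields `exp (g v) - g v` as a lower bound. Only a
first moment of `Z` is needed. -/
theorem exp_norm_sub_le_integral_exp_inner [FiniteDimensional ℝ E] [IsProbabilityMeasure ρ]
    {Z : 𝒳 → E} (hZ : Integrable Z ρ) (hmean : ∫ x, Z x ∂ρ = 0)
    (hnd : ∀ c : E, (∀ᵐ x ∂ρ, inner ℝ c (Z x) = 0) → c = 0) :
    ∃ a > 0, ∀ v : E, Integrable (fun x => Real.exp (inner ℝ v (Z x))) ρ →
      Real.exp (a * ‖v‖) - a * ‖v‖ ≤ ∫ x, Real.exp (inner ℝ v (Z x)) ∂ρ := by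
  set g : E → ℝ := fun u => ∫ x, max (inner ℝ u (Z x)) 0 ∂ρ with hg
  have hgi : ∀ u, Integrable (fun x => max (inner ℝ u (Z x)) 0) ρ := fun u =>
    (hZ.const_inner u).pos_part
  have hmean' : ∀ u : E, ∫ x, inner ℝ u (Z x) ∂ρ = 0 := fun u => by
    rw [integral_inner hZ, hmean, inner_zero_right]
  have hcont : Continuous g := by
    rw [continuous_iff_continuousAt]
    intro u₀
    refine continuousAt_of_dominated (bound := fun x => (‖u₀‖ + 1) * ‖Z x‖)
      (Eventually.of_forall fun u => (hgi u).aestronglyMeasurable) ?_ (hZ.norm.const_mul _)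
      (ae_of_all _ fun x => by fun_prop)
    filter_upwards [Metric.ball_mem_nhds u₀ one_pos] with u hu
    refine ae_of_all _ fun x => ?_
    rw [Real.norm_of_nonneg (le_max_right _ _)]
    have h1 : ‖u‖ ≤ ‖u₀‖ + 1 := by
      have := norm_le_norm_add_norm_sub' u u₀
      rw [Metric.mem_ball, dist_eq_norm] at hu
      linarith
    refine max_le ((real_inner_le_norm _ _).trans (by gcongr)) (by positivity)
  have hpos : ∀ u ∈ Metric.sphere (0 : E) 1, 0 < g u := by
    intro u hu
    have h0 : 0 ≤ g u := integral_nonneg fun x => le_max_right _ _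
    refine lt_of_le_of_ne h0 fun h => ?_
    have h1 := (integral_eq_zero_iff_of_nonneg (fun x => le_max_right _ _) (hgi u)).1 h.symm
    have h2 : (fun x => - inner ℝ u (Z x)) =ᵐ[ρ] 0 := by
      refine (integral_eq_zero_iff_of_nonneg_ae ?_ (hZ.const_inner u).neg).1 ?_
      · filter_upwards [h1] with x hx
        have := max_eq_right_iff.1 hx
        simpa using this
      · simp only [Pi.neg_apply]
        rw [integral_neg, hmean', neg_zero]
    have h3 := hnd u (by filter_upwards [h2] with x hx; simpa using hx)
    simp [h3] at hu
  obtain ⟨a, ha, hle⟩ := (isCompact_sphere (0 : E) 1).exists_forall_le' hcont.continuousOn hpos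
  refine ⟨a, ha, fun v hv => ?_⟩
  have hav : a * ‖v‖ ≤ g v := by
    rcases eq_or_ne v 0 with rfl | hv0
    · simp [hg]
    · have h1 := hle (‖v‖⁻¹ • v) (by simp [norm_smul, hv0])
      have h2 : g (‖v‖⁻¹ • v) = ‖v‖⁻¹ * g v := by
        simp only [hg, ← integral_const_mul, real_inner_smul_left]
        congr 1; ext x
        rw [mul_max_of_nonneg _ _ (by positivity), mul_zero]
      rw [h2, inv_mul_eq_div, le_div_iff₀ (by positivity)] at h1
      exact h1
  refine (monotoneOn_exp_sub_id (Set.mem_Ici.2 (by positivity))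
    (Set.mem_Ici.2 (le_trans (by positivity) hav)) hav).trans ?_
  simp only
  -- Combines `exp y ≥ exp (max y 0) + (y - max y 0)` with the tangent line of `exp` at `g v`; its
  -- integral is exactly `exp (g v) - g v`.
  have hbd : ∀ x, Real.exp (g v) * (1 - g v) + Real.exp (g v) * max (inner ℝ v (Z x)) 0
      + (inner ℝ v (Z x) - max (inner ℝ v (Z x)) 0) ≤ Real.exp (inner ℝ v (Z x)) := by
    intro x
    set y : ℝ := inner ℝ v (Z x)
    have h1 := Real.add_one_le_exp (max y 0 - g v)
    have h2 : Real.exp (max y 0) = Real.exp (g v) * Real.exp (max y 0 - g v) := by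
      rw [← Real.exp_add]; ring_nf
    have h3 : Real.exp (g v) * (1 - g v) + Real.exp (g v) * max y 0 ≤ Real.exp (max y 0) := by
      rw [h2]; nlinarith [Real.exp_pos (g v)]
    rcases le_total y 0 with hy | hy
    · rw [max_eq_right hy] at h3 ⊢
      rw [Real.exp_zero] at h3
      linarith [Real.add_one_le_exp y]
    · rw [max_eq_left hy] at h3 ⊢
      linarith
  have hi1 := (hgi v).const_mul (Real.exp (g v))
  have hi2 : Integrable (fun x => Real.exp (g v) * (1 - g v)
      + Real.exp (g v) * max (inner ℝ v (Z x)) 0) ρ := (integrable_const _).add hi1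
  have hi3 : Integrable (fun x => inner ℝ v (Z x) - max (inner ℝ v (Z x)) 0) ρ :=
    (hZ.const_inner v).sub (hgi v)
  calc _ = ∫ x, (Real.exp (g v) * (1 - g v) + Real.exp (g v) * max (inner ℝ v (Z x)) 0
      + (inner ℝ v (Z x) - max (inner ℝ v (Z x)) 0)) ∂ρ := by
        rw [integral_add hi2 hi3, integral_add (integrable_const _) hi1,
          integral_sub (hZ.const_inner v) (hgi v), hmean', integral_const, probReal_univ,
          one_smul, integral_const_mul]
        change _ = Real.exp (g v) * (1 - g v) + Real.exp (g v) * g v + (0 - g v)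
        ring
    _ ≤ _ := integral_mono (hi2.add hi3) hv hbd

variable [MeasurableSpace E]

theorem convexSupport_map_subset_of_absolutelyContinuous {ρ' : Measure 𝒳} (h : ρ ≪ ρ')
    {Y : 𝒳 → E} (hY : Measurable Y) :
    convexSupport (ρ.map Y) ⊆ convexSupport (ρ'.map Y) := by
  intro p hp C hC
  exact hp C ⟨hC.1, hC.2.1, h.map hY hC.2.2⟩

variable [BorelSpace E]

/-- Otherwise a closed half-space at distance `r / 3` from `p` would have full measure and so
contain the convex support, yet it misses `p + (r / 2) • u`. The radius `r` of a ball around `p`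
serves all directions at once. -/
theorem exists_not_ae_inner_sub_le_of_mem_interior_convexSupport {Y : 𝒳 → E}
    (hY : Measurable Y) {p : E} (hp : p ∈ interior (convexSupport (ρ.map Y))) :
    ∃ δ > 0, ∀ u : E, ‖u‖ = 1 → ¬ ∀ᵐ x ∂ρ, inner ℝ u (Y x - p) ≤ δ := by
  obtain ⟨r, hr, hball⟩ := Metric.mem_nhds_iff.1 (mem_interior_iff_mem_nhds.1 hp)
  refine ⟨r / 3, by positivity, fun u hu hae => ?_⟩
  set C : Set E := {y | inner ℝ u (y - p) ≤ r / 3} with hC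
  have hCc : IsClosed C := isClosed_le (by fun_prop) continuous_const
  have hCconv : Convex ℝ C := by
    have : C = {y | innerSL ℝ u y ≤ r / 3 + inner ℝ u p} := by
      ext y; simp [hC, inner_sub_right]
    rw [this]
    exact convex_halfSpace_le (innerSL ℝ u).toLinearMap.isLinear _
  have hCm : ρ.map Y Cᶜ = 0 := by
    rw [Measure.map_apply hY hCc.measurableSet.compl]
    exact hae
  have hmem : p + (r / 2) • u ∈ convexSupport (ρ.map Y) := by
    apply hball
    simp [Metric.mem_ball, dist_eq_norm, norm_smul, hu, abs_of_pos hr]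
    linarith
  have h1 : p + (r / 2) • u ∈ C := hmem C ⟨hCc, hCconv, hCm⟩
  simp [hC, real_inner_smul_right, hu] at h1
  linarith

variable [FiniteDimensional ℝ E] {Z : 𝒳 → E}

/-- Half of the exponent is spent on absorbing the square, via `x ^ 2 / 2 ≤ exp x` at `x = s t / 2`.
-/
theorem sq_mul_exp_half_le {s t : ℝ} (hs : 0 < s) (ht : 0 ≤ t) :
    t ^ 2 * Real.exp (s / 2 * t) ≤ 8 / s ^ 2 * Real.exp (s * t) := by
  have h1 := Real.quadratic_le_exp_of_nonneg (x := s / 2 * t) (by positivity)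
  have h2 : t ^ 2 ≤ 8 / s ^ 2 * Real.exp (s / 2 * t) := by
    rw [div_mul_eq_mul_div, le_div_iff₀ (by positivity)]
    nlinarith [mul_nonneg hs.le ht]
  have h3 : Real.exp (s * t) = Real.exp (s / 2 * t) * Real.exp (s / 2 * t) := by
    rw [← Real.exp_add]; ring_nf
  rw [h3, ← mul_assoc]
  exact mul_le_mul_of_nonneg_right h2 (Real.exp_pos _).le

theorem integrable_norm_sq_of_integrable_exp_mul_norm (hZ : Measurable Z) {s : ℝ} (hs : 0 < s)
    (h : Integrable (fun x => Real.exp (s * ‖Z x‖)) ρ) :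
    Integrable (fun x => ‖Z x‖ ^ 2) ρ := by
  refine (h.const_mul (8 / s ^ 2)).mono' (by fun_prop) (ae_of_all _ fun x => ?_)
  rw [Real.norm_of_nonneg (by positivity)]
  refine le_trans ?_ (sq_mul_exp_half_le hs (norm_nonneg (Z x)))
  exact le_mul_of_one_le_right (by positivity) (Real.one_le_exp (by positivity))

theorem integrable_of_integrable_exp_mul_norm (hZ : Measurable Z) {s : ℝ} (hs : 0 < s)
    (h : Integrable (fun x => Real.exp (s * ‖Z x‖)) ρ) : Integrable Z ρ := by
  refine (h.const_mul s⁻¹).mono' (by fun_prop) (ae_of_all _ fun x => ?_)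
  rw [inv_mul_eq_div, le_div_iff₀ hs]
  linarith [Real.add_one_le_exp (s * ‖Z x‖)]

theorem integral_exp_inner_le [IsProbabilityMeasure ρ] (hZ : Measurable Z) {s : ℝ} (hs : 0 < s)
    (h : Integrable (fun x => Real.exp (s * ‖Z x‖)) ρ) (hmean : ∫ x, Z x ∂ρ = 0) :
    ∃ C > 0, ∀ v : E, ‖v‖ ≤ s / 2 → ∫ x, Real.exp (inner ℝ v (Z x)) ∂ρ ≤ 1 + C * ‖v‖ ^ 2 := by
  refine ⟨8 / s ^ 2 * ∫ x, Real.exp (s * ‖Z x‖) ∂ρ, ?_, fun v hv => ?_⟩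
  · have : 0 < ∫ x, Real.exp (s * ‖Z x‖) ∂ρ := integral_exp_pos h
    positivity
  have hZi := integrable_of_integrable_exp_mul_norm hZ hs h
  have hbd : ∀ x, Real.exp (inner ℝ v (Z x)) ≤
      1 + inner ℝ v (Z x) + ‖v‖ ^ 2 * (8 / s ^ 2 * Real.exp (s * ‖Z x‖)) := by
    intro x
    have h1 := abs_real_inner_le_norm v (Z x)
    have h2 : (inner ℝ v (Z x)) ^ 2 ≤ ‖v‖ ^ 2 * ‖Z x‖ ^ 2 := by
      rw [← mul_pow, ← sq_abs]; gcongr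
    have h3 : |inner ℝ v (Z x)| ≤ s / 2 * ‖Z x‖ := h1.trans (by gcongr)
    calc _ ≤ 1 + inner ℝ v (Z x) + (inner ℝ v (Z x)) ^ 2 * Real.exp |inner ℝ v (Z x)| :=
          exp_le_one_add_add_sq_mul_exp_abs _
      _ ≤ 1 + inner ℝ v (Z x) + ‖v‖ ^ 2 * ‖Z x‖ ^ 2 * Real.exp (s / 2 * ‖Z x‖) := by gcongr
      _ ≤ _ := by
        rw [mul_assoc]
        have h4 := sq_mul_exp_half_le hs (norm_nonneg (Z x))
        linarith [mul_le_mul_of_nonneg_left h4 (sq_nonneg ‖v‖)]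
  have hi1 : Integrable (fun x => inner ℝ v (Z x)) ρ := hZi.const_inner v
  have hi2 : Integrable (fun x => 1 + inner ℝ v (Z x)) ρ := (integrable_const _).add hi1
  have hi3 := (h.const_mul (8 / s ^ 2)).const_mul (‖v‖ ^ 2)
  calc _ ≤ ∫ x, (1 + inner ℝ v (Z x) + ‖v‖ ^ 2 * (8 / s ^ 2 * Real.exp (s * ‖Z x‖))) ∂ρ :=
        integral_mono_of_nonneg (ae_of_all _ fun x => (Real.exp_pos _).le) (hi2.add hi3)
          (ae_of_all _ hbd)
    _ = _ := by
      rw [integral_add hi2 hi3, integral_add (integrable_const _) hi1, integral_inner hZi, hmean,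
        integral_const_mul, integral_const_mul]
      simp
      ring

theorem exp_norm_le_integral_exp_inner [IsProbabilityMeasure ρ] (hZ : Measurable Z)
    {δ : ℝ}
    (hsupp : ∀ u : E, ‖u‖ = 1 → ¬ ∀ᵐ x ∂ρ, inner ℝ u (Z x) ≤ δ) :
    ∃ ε > 0, ∀ v : E, Integrable (fun x => Real.exp (inner ℝ v (Z x))) ρ →
      ε * Real.exp (δ * ‖v‖) ≤ ∫ x, Real.exp (inner ℝ v (Z x)) ∂ρ := by
  -- A continuous minorant of the indicator of `(δ, ∞)`: continuity makes its mean continuous in the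
  -- direction, so compactness gives one `ε` for the whole sphere.
  set φ : ℝ → ℝ := fun s => min 1 (max (s - δ) 0) with hφ
  have hφ0 : ∀ s, 0 ≤ φ s := fun s => le_min zero_le_one (le_max_right _ _)
  have hφ1 : ∀ s, φ s ≤ 1 := fun s => min_le_left _ _
  have hφc : Continuous φ := by fun_prop
  have hφm : ∀ u : E, Integrable (fun x => φ (inner ℝ u (Z x))) ρ := fun u =>
    (integrable_const (1 : ℝ)).mono'
      (hφc.measurable.comp (hZ.const_inner)).aestronglyMeasurable
      (ae_of_all _ fun x => by rw [Real.norm_of_nonneg (hφ0 _)]; exact hφ1 _)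
  set g : E → ℝ := fun u => ∫ x, φ (inner ℝ u (Z x)) ∂ρ with hg
  have hcont : Continuous g :=
    continuous_of_dominated (bound := fun _ => 1) (fun u => (hφm u).aestronglyMeasurable)
      (fun u => ae_of_all _ fun x => by rw [Real.norm_of_nonneg (hφ0 _)]; exact hφ1 _)
      (integrable_const _) (ae_of_all _ fun x => by fun_prop)
  have hpos : ∀ u ∈ Metric.sphere (0 : E) 1, 0 < g u := by
    intro u hu
    refine lt_of_le_of_ne (integral_nonneg fun x => hφ0 _) fun h => ?_
    have h1 := (integral_eq_zero_iff_of_nonneg (fun x => hφ0 _) (hφm u)).1 h.symm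
    refine hsupp u (by simpa using hu) ?_
    filter_upwards [h1] with x hx
    by_contra hlt
    push Not at hlt
    have : 0 < φ (inner ℝ u (Z x)) := lt_min one_pos (lt_max_of_lt_left (by linarith))
    exact this.ne' hx
  obtain ⟨ε, hε, hle⟩ := (isCompact_sphere (0 : E) 1).exists_forall_le' hcont.continuousOn hpos
  -- The cap at `1` is for `v = 0`, where the moment equals one.
  refine ⟨min ε 1, lt_min hε one_pos, fun v hv => ?_⟩
  rcases eq_or_ne v 0 with rfl | hv0
  · simp
  have hv0' : 0 < ‖v‖ := norm_pos_iff.2 hv0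
  have h1 := hle (‖v‖⁻¹ • v) (by simp [norm_smul, hv0])
  calc min ε 1 * Real.exp (δ * ‖v‖) ≤ g (‖v‖⁻¹ • v) * Real.exp (δ * ‖v‖) := by
        gcongr; exact (min_le_left _ _).trans h1
    _ = ∫ x, φ (inner ℝ (‖v‖⁻¹ • v) (Z x)) * Real.exp (δ * ‖v‖) ∂ρ := by
        rw [integral_mul_const]
    _ ≤ _ := by
        refine integral_mono ((hφm _).mul_const _) hv fun x => ?_
        simp only [real_inner_smul_left]
        set y : ℝ := inner ℝ v (Z x)
        rcases le_or_gt (‖v‖⁻¹ * y) δ with hy | hy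
        · have : φ (‖v‖⁻¹ * y) = 0 := by simp [hφ, hy]
          rw [this, zero_mul]
          positivity
        · calc _ ≤ 1 * Real.exp (δ * ‖v‖) := by gcongr; exact hφ1 _
            _ ≤ _ := by
              rw [one_mul, Real.exp_le_exp]
              rw [inv_mul_eq_div, lt_div_iff₀ hv0'] at hy
              exact hy.le

theorem integrable_exp_neg_mul_norm (μ : Measure E) [μ.IsAddHaarMeasure] {c : ℝ} (hc : 0 < c) :
    Integrable (fun x : E => Real.exp (-(c * ‖x‖))) μ := by
  set N : ℕ := Module.finrank ℝ E + 1 with hN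
  have h1 : Integrable (fun x : E => (1 + ‖x‖) ^ (-(N : ℝ))) μ :=
    integrable_one_add_norm (by rw [hN]; push_cast; linarith)
  set b := min c 1 with hb
  have hb0 : 0 < b := lt_min hc one_pos
  refine (h1.const_mul (b⁻¹ ^ N * N.factorial * Real.exp b)).mono' (by fun_prop)
    (ae_of_all _ fun x => ?_)
  rw [Real.norm_of_nonneg (Real.exp_pos _).le]
  have hx : 0 < 1 + ‖x‖ := by positivity
  have h2 := Real.pow_div_factorial_le_exp (x := b * (1 + ‖x‖)) (by positivity) N
  have h3 : (1 + ‖x‖) ^ N ≤ b⁻¹ ^ N * N.factorial * Real.exp (b * (1 + ‖x‖)) := by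
    rw [div_le_iff₀ (by positivity), mul_pow] at h2
    rw [inv_pow, mul_assoc, inv_mul_eq_div, le_div_iff₀ (by positivity)]
    linarith
  rw [Real.rpow_neg hx.le, Real.rpow_natCast, ← div_eq_mul_inv, le_div_iff₀ (by positivity)]
  calc _ ≤ Real.exp (-(c * ‖x‖)) * (b⁻¹ ^ N * N.factorial * Real.exp (b * (1 + ‖x‖))) := by gcongr
    _ = b⁻¹ ^ N * N.factorial * Real.exp (-(c * ‖x‖) + b * (1 + ‖x‖)) := by
      rw [Real.exp_add]; ring
    _ ≤ _ := by
      gcongr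
      nlinarith [min_le_left c 1, norm_nonneg x]

end ExponentialMoments

/-- Turns the lower bound for exponential moments into one for their logarithm, quadratic near zero
and linear far away. -/
theorem exp_min_div_four_le {s : ℝ} (hs : 0 ≤ s) :
    Real.exp (min (s ^ 2) s / 4) ≤ Real.exp s - s := by
  rcases le_total s 1 with h | h
  · rw [min_eq_left (by nlinarith)]
    have h1 := Real.quadratic_le_exp_of_nonneg hs
    have h2 := Real.add_one_le_exp (-(s ^ 2 / 4))
    have h3 : Real.exp (s ^ 2 / 4) * Real.exp (-(s ^ 2 / 4)) = 1 := by rw [← Real.exp_add]; simp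
    have h4 := Real.exp_pos (s ^ 2 / 4)
    have h5 : s ^ 2 ≤ 1 := by nlinarith
    have h6 : Real.exp (s ^ 2 / 4) * (1 - s ^ 2 / 4) ≤ 1 := by nlinarith
    have h7 : 1 ≤ (1 + s ^ 2 / 2) * (1 - s ^ 2 / 4) := by nlinarith [sq_nonneg s]
    have h8 : Real.exp (s ^ 2 / 4) ≤ 1 + s ^ 2 / 2 := by
      by_contra hc
      push Not at hc
      nlinarith
    linarith
  · rw [min_eq_right (by nlinarith)]
    have h1 := Real.add_one_le_exp (s / 4)
    set y := Real.exp (s / 4)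
    have h2 : Real.exp s = y ^ 4 := by rw [← Real.exp_nat_mul]; congr 1; push_cast; ring
    have hy : 5 / 4 ≤ y := by linarith
    -- This product is `y ^ 4 - y - 4 (y - 1)`, and `s ≤ 4 (y - 1)`.
    have h3 : 0 ≤ (y - 1) * (y ^ 3 + y ^ 2 + y - 4) := by
      refine mul_nonneg (by linarith) ?_
      nlinarith [sq_nonneg y, mul_nonneg (sub_nonneg.2 hy) (sub_nonneg.2 hy),
        mul_nonneg (sq_nonneg y) (sub_nonneg.2 hy)]
    rw [h2]
    nlinarith

/-! ### Divergence and mean in an exponential family. -/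

namespace ExpFamily

variable {𝒳 : Type*} [MeasurableSpace 𝒳] {d : ℕ} (G : ExpFamily 𝒳 d)
  {θ θ' : EuclideanSpace ℝ (Fin d)}

/-- The mean of the sufficient statistic. -/
noncomputable def mean (θ : EuclideanSpace ℝ (Fin d)) : EuclideanSpace ℝ (Fin d) :=
  ∫ x, G.T x ∂(G.law θ)

/-- The Kullback-Leibler divergence of the member `θ'` from the member `θ`, written as the Bregman
divergence of the log-partition function. -/
noncomputable def divergence (θ θ' : EuclideanSpace ℝ (Fin d)) : ℝ :=
  G.logPartition θ' - G.logPartition θ - inner ℝ (G.mean θ) (θ' - θ)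

theorem measurable_density (θ : EuclideanSpace ℝ (Fin d)) : Measurable (G.density θ) := by
  have h1 := G.measurable_h
  have h2 : Measurable fun x => inner ℝ θ (G.T x) := G.measurable_T.const_inner
  unfold density
  fun_prop

theorem density_nonneg (θ : EuclideanSpace ℝ (Fin d)) (x : 𝒳) : 0 ≤ G.density θ x :=
  mul_nonneg (G.h_nonneg x) (Real.exp_pos _).le

theorem exp_logPartition (hθ : θ ∈ G.naturalSpace) :
    Real.exp (G.logPartition θ) = G.partitionFn θ := Real.exp_log hθ.2

theorem density_mul_exp_inner (θ θ' : EuclideanSpace ℝ (Fin d)) (x : 𝒳) :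
    G.density θ x * Real.exp (inner ℝ (θ' - θ) (G.T x)) =
      Real.exp (-G.logPartition θ) * (G.h x * Real.exp (inner ℝ θ' (G.T x))) := by
  have : Real.exp (inner ℝ θ (G.T x) - G.logPartition θ) * Real.exp (inner ℝ (θ' - θ) (G.T x)) =
      Real.exp (-G.logPartition θ) * Real.exp (inner ℝ θ' (G.T x)) := by
    rw [← Real.exp_add, ← Real.exp_add, inner_sub_left]
    ring_nf
  rw [density, mul_assoc, this]
  ring

theorem integrable_law_iff {f : 𝒳 → ℝ} :
    Integrable f (G.law θ) ↔ Integrable (fun x => G.density θ x * f x) G.ν := by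
  rw [law, integrable_withDensity_iff_integrable_smul' (G.measurable_density θ).ennreal_ofReal
    (ae_of_all _ fun _ => ENNReal.ofReal_lt_top)]
  simp [ENNReal.toReal_ofReal (G.density_nonneg θ _)]

theorem integral_law (f : 𝒳 → ℝ) :
    ∫ x, f x ∂(G.law θ) = ∫ x, G.density θ x * f x ∂G.ν := by
  rw [law, integral_withDensity_eq_integral_toReal_smul (G.measurable_density θ).ennreal_ofReal
    (ae_of_all _ fun _ => ENNReal.ofReal_lt_top)]
  simp [ENNReal.toReal_ofReal (G.density_nonneg θ _)]

theorem integrable_exp_inner_law (θ : EuclideanSpace ℝ (Fin d)) (hθ' : θ' ∈ G.naturalSpace) :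
    Integrable (fun x => Real.exp (inner ℝ (θ' - θ) (G.T x))) (G.law θ) := by
  rw [integrable_law_iff]
  simp only [density_mul_exp_inner]
  exact hθ'.1.const_mul _

theorem integral_exp_inner_law (θ : EuclideanSpace ℝ (Fin d)) (hθ' : θ' ∈ G.naturalSpace) :
    ∫ x, Real.exp (inner ℝ (θ' - θ) (G.T x)) ∂(G.law θ) =
      Real.exp (G.logPartition θ' - G.logPartition θ) := by
  rw [integral_law]
  simp only [density_mul_exp_inner]
  rw [integral_const_mul, sub_eq_neg_add, Real.exp_add, G.exp_logPartition hθ', partitionFn]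

theorem isProbabilityMeasure_law (hθ : θ ∈ G.naturalSpace) : IsProbabilityMeasure (G.law θ) := by
  have h1 := G.integrable_exp_inner_law θ hθ
  have h2 := G.integral_exp_inner_law θ hθ
  simp only [sub_self, inner_zero_left, Real.exp_zero, integral_const, smul_eq_mul, mul_one] at h1 h2
  have h3 := (integrable_const_iff.1 h1).resolve_left one_ne_zero
  exact ⟨by rw [← ENNReal.toReal_eq_one_iff]; exact h2⟩

theorem exp_inner_sub (v p : EuclideanSpace ℝ (Fin d)) (x : 𝒳) :
    Real.exp (inner ℝ v (G.T x - p)) =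
      Real.exp (-inner ℝ v p) * Real.exp (inner ℝ v (G.T x)) := by
  rw [← Real.exp_add, inner_sub_right, sub_eq_neg_add]

theorem integrable_exp_inner_sub_law (θ p : EuclideanSpace ℝ (Fin d)) (hθ' : θ' ∈ G.naturalSpace) :
    Integrable (fun x => Real.exp (inner ℝ (θ' - θ) (G.T x - p))) (G.law θ) := by
  simp only [exp_inner_sub]
  exact (G.integrable_exp_inner_law θ hθ').const_mul _

theorem integral_exp_inner_sub_law (θ p : EuclideanSpace ℝ (Fin d)) (hθ' : θ' ∈ G.naturalSpace) :
    ∫ x, Real.exp (inner ℝ (θ' - θ) (G.T x - p)) ∂(G.law θ) =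
      Real.exp (G.logPartition θ' - G.logPartition θ - inner ℝ p (θ' - θ)) := by
  simp only [exp_inner_sub]
  rw [integral_const_mul, G.integral_exp_inner_law θ hθ', ← Real.exp_add, real_inner_comm,
    sub_eq_neg_add _ (inner ℝ _ _)]

/-- The bridge by which bounds on exponential moments become bounds on the divergence. -/
theorem exp_divergence (θ : EuclideanSpace ℝ (Fin d)) (hθ' : θ' ∈ G.naturalSpace) :
    Real.exp (G.divergence θ θ') =
      ∫ x, Real.exp (inner ℝ (θ' - θ) (G.T x - G.mean θ)) ∂(G.law θ) :=
  (G.integral_exp_inner_sub_law θ _ hθ').symm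

/-- Each density is positive exactly where `h` is, so all members have the same null sets. -/
theorem law_absolutelyContinuous (θ θ' : EuclideanSpace ℝ (Fin d)) : G.law θ ≪ G.law θ' := by
  intro s hs
  rw [law, withDensity_apply_eq_zero (G.measurable_density _).ennreal_ofReal] at hs ⊢
  convert hs using 4
  simp [density, mul_pos_iff_of_pos_right (Real.exp_pos _)]

theorem ae_h_pos (θ : EuclideanSpace ℝ (Fin d)) : ∀ᵐ x ∂(G.law θ), 0 < G.h x := by
  rw [ae_iff, law, withDensity_apply_eq_zero (G.measurable_density _).ennreal_ofReal]
  convert measure_empty (μ := G.ν)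
  ext x
  simp [density, mul_pos_iff_of_pos_right (Real.exp_pos _)]

section Open

variable {G}

theorem exists_integrable_exp_norm_sub (hΘ : IsOpen G.naturalSpace)
    (hθ : θ ∈ G.naturalSpace) (p : EuclideanSpace ℝ (Fin d)) :
    ∃ s > 0, Integrable (fun x => Real.exp (s * ‖G.T x - p‖)) (G.law θ) := by
  have := G.isProbabilityMeasure_law hθ
  obtain ⟨r, hr, hball⟩ := Metric.isOpen_iff.1 hΘ θ hθ
  refine integrable_exp_mul_norm_of_integrable_exp_inner (G.measurable_T.sub_const p) hr
    fun v hv => ?_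
  have h1 : θ + v ∈ G.naturalSpace := hball (by simpa [dist_eq_norm] using hv)
  simpa using G.integrable_exp_inner_sub_law θ p h1

theorem integrable_norm_sq_sub (hΘ : IsOpen G.naturalSpace) (hθ : θ ∈ G.naturalSpace)
    (p : EuclideanSpace ℝ (Fin d)) : Integrable (fun x => ‖G.T x - p‖ ^ 2) (G.law θ) := by
  obtain ⟨s, hs, h⟩ := exists_integrable_exp_norm_sub hΘ hθ p
  exact integrable_norm_sq_of_integrable_exp_mul_norm (G.measurable_T.sub_const p) hs h

theorem integrable_T (hΘ : IsOpen G.naturalSpace) (hθ : θ ∈ G.naturalSpace) :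
    Integrable G.T (G.law θ) := by
  obtain ⟨s, hs, h⟩ := exists_integrable_exp_norm_sub hΘ hθ 0
  simpa using integrable_of_integrable_exp_mul_norm (G.measurable_T.sub_const 0) hs h

theorem integrable_T_sub (hΘ : IsOpen G.naturalSpace) (hθ : θ ∈ G.naturalSpace)
    (p : EuclideanSpace ℝ (Fin d)) : Integrable (fun x => G.T x - p) (G.law θ) :=
  have := G.isProbabilityMeasure_law hθ
  (integrable_T hΘ hθ).sub (integrable_const p)

theorem integral_T_sub_mean (hΘ : IsOpen G.naturalSpace) (hθ : θ ∈ G.naturalSpace) :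
    ∫ x, (G.T x - G.mean θ) ∂(G.law θ) = 0 := by
  have := G.isProbabilityMeasure_law hθ
  rw [integral_sub (integrable_T hΘ hθ) (integrable_const _)]
  simp [mean]

theorem divergence_nonneg (hΘ : IsOpen G.naturalSpace) (hθ : θ ∈ G.naturalSpace)
    (hθ' : θ' ∈ G.naturalSpace) : 0 ≤ G.divergence θ θ' := by
  have := G.isProbabilityMeasure_law hθ
  rw [← Real.one_le_exp_iff, G.exp_divergence θ hθ']
  have hi := (integrable_T_sub hΘ hθ (G.mean θ)).const_inner (𝕜 := ℝ) (θ' - θ)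
  have h1 : ∫ x, (inner ℝ (θ' - θ) (G.T x - G.mean θ) + 1) ∂(G.law θ) = 1 := by
    refine (integral_add hi (integrable_const _)).trans ?_
    rw [integral_inner (integrable_T_sub hΘ hθ _), integral_T_sub_mean hΘ hθ]
    simp
  rw [← h1]
  exact integral_mono (hi.add (integrable_const _)) (G.integrable_exp_inner_sub_law θ _ hθ')
    fun x => Real.add_one_le_exp _

theorem exists_divergence_le (hΘ : IsOpen G.naturalSpace) (hθ : θ ∈ G.naturalSpace) :
    ∃ C > 0, ∃ δ > 0, ∀ θ', ‖θ' - θ‖ ≤ δ →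
      θ' ∈ G.naturalSpace ∧ G.divergence θ θ' ≤ C * ‖θ' - θ‖ ^ 2 := by
  have := G.isProbabilityMeasure_law hθ
  obtain ⟨s, hs, h⟩ := exists_integrable_exp_norm_sub hΘ hθ (G.mean θ)
  obtain ⟨C, hC, hle⟩ := integral_exp_inner_le (G.measurable_T.sub_const _) hs h
    (integral_T_sub_mean hΘ hθ)
  obtain ⟨r, hr, hball⟩ := Metric.isOpen_iff.1 hΘ θ hθ
  refine ⟨C, hC, min (s / 2) (r / 2), by positivity, fun θ' hθ' => ?_⟩
  have hmem : θ' ∈ G.naturalSpace := hball (by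
    rw [Metric.mem_ball, dist_eq_norm]
    linarith [hθ'.trans (min_le_right _ _)])
  refine ⟨hmem, ?_⟩
  have h1 := hle (θ' - θ) (hθ'.trans (min_le_left _ _))
  rw [← G.exp_divergence θ hmem] at h1
  linarith [Real.add_one_le_exp (G.divergence θ θ')]

/-- The divergence is the first-order remainder of the log-partition function and is quadratically
small, so no differentiation under the integral is required. -/
theorem hasGradientAt_logPartition (hΘ : IsOpen G.naturalSpace) (hθ : θ ∈ G.naturalSpace) :
    HasGradientAt G.logPartition (G.mean θ) θ := by
  obtain ⟨C, hC, δ, hδ, h⟩ := exists_divergence_le hΘ hθ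
  rw [hasGradientAt_iff_isLittleO]
  have h1 : (fun θ' => G.divergence θ θ') =O[𝓝 θ] fun θ' => ‖θ' - θ‖ ^ 2 := by
    refine Asymptotics.IsBigO.of_bound C ?_
    filter_upwards [Metric.closedBall_mem_nhds θ hδ] with θ' hθ'
    rw [Metric.mem_closedBall, dist_eq_norm] at hθ'
    obtain ⟨hm, hle⟩ := h θ' hθ'
    rw [Real.norm_of_nonneg (divergence_nonneg hΘ hθ hm), Real.norm_of_nonneg (by positivity)]
    exact hle
  refine h1.trans_isLittleO ?_
  have h2 : (fun θ' : EuclideanSpace ℝ (Fin d) => ‖θ' - θ‖ ^ 2) =o[𝓝 θ]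
      fun θ' => ‖θ' - θ‖ ^ 1 :=
    (Asymptotics.isLittleO_pow_pow one_lt_two).comp_tendsto
      (by simpa using (tendsto_norm_sub_self θ))
  simpa using h2.norm_right

theorem gradient_logPartition (hΘ : IsOpen G.naturalSpace) (hθ : θ ∈ G.naturalSpace) :
    gradient G.logPartition θ = G.mean θ := (hasGradientAt_logPartition hΘ hθ).gradient

theorem continuousOn_logPartition (hΘ : IsOpen G.naturalSpace) :
    ContinuousOn G.logPartition G.naturalSpace := fun _ hθ =>
  (hasGradientAt_logPartition hΘ hθ).continuousAt.continuousWithinAt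

theorem exists_le_divergence (hG : G.IsFullRank) (hΘ : IsOpen G.naturalSpace)
    (hθ : θ ∈ G.naturalSpace) :
    ∃ c > 0, ∀ θ' ∈ G.naturalSpace,
      c * min (‖θ' - θ‖ ^ 2) ‖θ' - θ‖ ≤ G.divergence θ θ' := by
  have := G.isProbabilityMeasure_law hθ
  obtain ⟨a, ha, hle⟩ := exp_norm_sub_le_integral_exp_inner
    (integrable_T_sub hΘ hθ (G.mean θ)) (integral_T_sub_mean hΘ hθ)
    fun c hc => hG θ hθ c (inner ℝ c (G.mean θ)) (by
      filter_upwards [hc] with x hx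
      rw [inner_sub_right] at hx
      linarith)
  refine ⟨min (a ^ 2) a / 4, by positivity, fun θ' hθ' => ?_⟩
  have h1 := hle (θ' - θ) (G.integrable_exp_inner_sub_law θ _ hθ')
  rw [← G.exp_divergence θ hθ'] at h1
  have h2 := (exp_min_div_four_le (by positivity : 0 ≤ a * ‖θ' - θ‖)).trans h1
  rw [Real.exp_le_exp] at h2
  refine le_trans ?_ h2
  rw [div_mul_eq_mul_div, mul_pow]
  gcongr
  refine le_min ?_ ?_ <;> gcongr <;> simp

theorem divergence_pos (hG : G.IsFullRank) (hΘ : IsOpen G.naturalSpace)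
    (hθ : θ ∈ G.naturalSpace) (hθ' : θ' ∈ G.naturalSpace) (hne : θ' ≠ θ) :
    0 < G.divergence θ θ' := by
  obtain ⟨c, hc, h⟩ := exists_le_divergence hG hΘ hθ
  have : 0 < ‖θ' - θ‖ := norm_pos_iff.2 (sub_ne_zero.2 hne)
  exact lt_of_lt_of_le (by positivity) (h θ' hθ')

/-- The two opposite divergences add up to `⟨mean θ' - mean θ, θ' - θ⟩`, which cannot vanish when
both are positive. -/
theorem eq_of_mean_eq (hG : G.IsFullRank) (hΘ : IsOpen G.naturalSpace)
    (hθ : θ ∈ G.naturalSpace) (hθ' : θ' ∈ G.naturalSpace) (h : G.mean θ' = G.mean θ) :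
    θ' = θ := by
  by_contra hne
  have h1 := divergence_pos hG hΘ hθ hθ' hne
  have h2 := divergence_pos hG hΘ hθ' hθ (Ne.symm hne)
  rw [divergence] at h1 h2
  rw [h, ← neg_sub θ' θ, inner_neg_right] at h2
  linarith

theorem exists_linear_growth (hθ : θ ∈ G.naturalSpace) {p : EuclideanSpace ℝ (Fin d)}
    (hp : p ∈ interior (convexSupport ((G.law θ).map G.T))) :
    ∃ c > 0, ∃ C, ∀ θ' ∈ G.naturalSpace,
      c * ‖θ'‖ - C ≤ G.logPartition θ' - inner ℝ p θ' := by
  have := G.isProbabilityMeasure_law hθ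
  obtain ⟨δ, hδ, hsupp⟩ :=
    exists_not_ae_inner_sub_le_of_mem_interior_convexSupport G.measurable_T hp
  obtain ⟨ε, hε, hle⟩ := exp_norm_le_integral_exp_inner (G.measurable_T.sub_const p) hsupp
  refine ⟨δ, hδ, δ * ‖θ‖ - Real.log ε - G.logPartition θ + inner ℝ p θ, fun θ' hθ' => ?_⟩
  have h1 := hle (θ' - θ) (G.integrable_exp_inner_sub_law θ p hθ')
  rw [G.integral_exp_inner_sub_law θ p hθ', ← Real.exp_log hε, ← Real.exp_add,
    Real.exp_le_exp, inner_sub_right] at h1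
  have h2 : ‖θ'‖ ≤ ‖θ' - θ‖ + ‖θ‖ := norm_le_norm_sub_add θ' θ
  nlinarith

end Open

end ExpFamily

/-! ### Laplace estimates for conjugate masses. -/

namespace ExpFamily

variable {𝒳 : Type*} [MeasurableSpace 𝒳] {d : ℕ} (G : ExpFamily 𝒳 d)
  {θ τ : EuclideanSpace ℝ (Fin d)} {m : ℝ}

/-- The total mass of the unnormalized conjugate prior with hyperparameters `τ`, `m`. -/
noncomputable def conjugateMass (τ : EuclideanSpace ℝ (Fin d)) (m : ℝ) : ℝ :=
  ∫ θ in G.naturalSpace, Real.exp (inner ℝ τ θ - m * G.logPartition θ)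

theorem likelihood_eq (n : ℕ) (x : ℕ → 𝒳) (θ : EuclideanSpace ℝ (Fin d)) :
    G.likelihood n x θ = (∏ i ∈ Finset.range n, G.h (x i)) *
      Real.exp (inner ℝ (∑ i ∈ Finset.range n, G.T (x i)) θ - n * G.logPartition θ) := by
  simp only [likelihood, density, Finset.prod_mul_distrib, ← Real.exp_sum,
    Finset.sum_sub_distrib, sum_inner, real_inner_comm]
  simp

theorem evidence_eq (τ : EuclideanSpace ℝ (Fin d)) (m : ℝ) (n : ℕ) (x : ℕ → 𝒳) :
    G.evidence τ m n x = (∏ i ∈ Finset.range n, G.h (x i)) * (G.conjugateMass τ m)⁻¹ *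
      G.conjugateMass (τ + ∑ i ∈ Finset.range n, G.T (x i)) (m + n) := by
  rw [evidence, conjugateMass.eq_def G (τ + _), ← integral_const_mul]
  congr 1
  ext θ
  have h : Real.exp (inner ℝ (τ + ∑ i ∈ Finset.range n, G.T (x i)) θ
      - (m + n) * G.logPartition θ) =
      Real.exp (inner ℝ (∑ i ∈ Finset.range n, G.T (x i)) θ - n * G.logPartition θ) *
        Real.exp (inner ℝ τ θ - m * G.logPartition θ) := by
    rw [← Real.exp_add, inner_add_left]
    ring_nf
  rw [likelihood_eq, prior, priorConst, h, conjugateMass]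
  ring

variable {G}

theorem exists_prior_le (hθ : θ ∈ G.naturalSpace) (hm : 0 < m)
    (hτ : m⁻¹ • τ ∈ interior (convexSupport ((G.law θ).map G.T))) :
    ∃ c > 0, ∃ C, ∀ θ' ∈ G.naturalSpace,
      inner ℝ τ θ' - m * G.logPartition θ' ≤ C - c * ‖θ'‖ := by
  obtain ⟨c, hc, C, h⟩ := exists_linear_growth hθ hτ
  refine ⟨m * c, by positivity, m * C, fun θ' hθ' => ?_⟩
  have h1 := mul_le_mul_of_nonneg_left (h θ' hθ') hm.le
  rw [real_inner_smul_left, mul_sub, mul_sub, mul_inv_cancel_left₀ hm.ne'] at h1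
  linarith

theorem continuousOn_exp_conjugate (hΘ : IsOpen G.naturalSpace)
    (τ : EuclideanSpace ℝ (Fin d)) (m : ℝ) :
    ContinuousOn (fun θ => Real.exp (inner ℝ τ θ - m * G.logPartition θ)) G.naturalSpace := by
  have := continuousOn_logPartition hΘ
  fun_prop

theorem conjugateMass_pos_of_integrableOn (hΘ : IsOpen G.naturalSpace) (hθ : θ ∈ G.naturalSpace)
    (h : IntegrableOn (fun θ => Real.exp (inner ℝ τ θ - m * G.logPartition θ)) G.naturalSpace) :
    0 < G.conjugateMass τ m := by
  have : NeZero (volume.restrict G.naturalSpace) :=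
    ⟨by rw [Ne, Measure.restrict_eq_zero]; exact (hΘ.measure_pos _ ⟨θ, hθ⟩).ne'⟩
  exact integral_exp_pos h

theorem integrableOn_prior (hΘ : IsOpen G.naturalSpace) (hθ : θ ∈ G.naturalSpace) (hm : 0 < m)
    (hτ : m⁻¹ • τ ∈ interior (convexSupport ((G.law θ).map G.T))) :
    IntegrableOn (fun θ => Real.exp (inner ℝ τ θ - m * G.logPartition θ)) G.naturalSpace := by
  obtain ⟨c, hc, C, h⟩ := exists_prior_le hθ hm hτ
  refine ((integrable_exp_neg_mul_norm volume hc).const_mul (Real.exp C)).integrableOn.mono'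
    ((continuousOn_exp_conjugate hΘ τ m).aestronglyMeasurable hΘ.measurableSet) ?_
  filter_upwards [ae_restrict_mem hΘ.measurableSet] with θ' hθ'
  rw [Real.norm_of_nonneg (Real.exp_pos _).le, ← Real.exp_add, Real.exp_le_exp]
  linarith [h θ' hθ']

theorem conjugateMass_pos (hΘ : IsOpen G.naturalSpace) (hθ : θ ∈ G.naturalSpace) (hm : 0 < m)
    (hτ : m⁻¹ • τ ∈ interior (convexSupport ((G.law θ).map G.T))) :
    0 < G.conjugateMass τ m :=
  conjugateMass_pos_of_integrableOn hΘ hθ (integrableOn_prior hΘ hθ hm hτ)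

/-- The exponent of the unnormalized posterior, centred at `θ`. -/
theorem posterior_exponent_eq (θ θ' τ s : EuclideanSpace ℝ (Fin d)) (m n : ℝ) :
    inner ℝ (τ + s) θ' - (m + n) * G.logPartition θ' =
      (inner ℝ s θ - n * G.logPartition θ) + (inner ℝ (s - n • G.mean θ) (θ' - θ)
        - n * G.divergence θ θ' + (inner ℝ τ θ' - m * G.logPartition θ')) := by
  simp only [divergence, inner_add_left, inner_sub_left, inner_sub_right, real_inner_smul_left]
  ring

theorem exists_posterior_exponent_le (hG : G.IsFullRank) (hΘ : IsOpen G.naturalSpace)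
    (hθ : θ ∈ G.naturalSpace) (hm : 0 < m)
    (hτ : m⁻¹ • τ ∈ interior (convexSupport ((G.law θ).map G.T))) {R : ℝ} (hR : 0 < R) :
    ∃ C, ∀ᶠ n : ℕ in atTop, ∀ s, ‖s - (n : ℝ) • G.mean θ‖ ≤ R * √n → ∀ θ' ∈ G.naturalSpace,
      inner ℝ (s - (n : ℝ) • G.mean θ) (θ' - θ) - n * G.divergence θ θ'
        + (inner ℝ τ θ' - m * G.logPartition θ') ≤ C - R * (√n * ‖θ' - θ‖) := by
  obtain ⟨b, hb, B, hB⟩ := exists_prior_le hθ hm hτ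
  obtain ⟨c, hc, hD⟩ := exists_le_divergence hG hΘ hθ
  -- With `x = √n * t`, the divergence term contributes at least `c (L x - L ^ 2) = 2 R x - c L ^
  -- 2`. Half of the `2 R x` beats the fluctuation term and the other half is the decay claimed.
  set L : ℝ := 2 * R / c with hL
  have hL0 : 0 < L := by positivity
  have hcL : c * L = 2 * R := by rw [hL]; field_simp
  have hlarge : ∀ᶠ n : ℕ in atTop, L ^ 2 ≤ n :=
    tendsto_natCast_atTop_atTop.eventually_ge_atTop _
  refine ⟨c * L ^ 2 + B, hlarge.mono fun n hn s hs θ' hθ' => ?_⟩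
  have hLn : L ≤ √n := Real.le_sqrt_of_sq_le hn
  have hsq : √(n : ℝ) ^ 2 = n := Real.sq_sqrt n.cast_nonneg
  set t := ‖θ' - θ‖
  have ht : 0 ≤ t := norm_nonneg _
  have h1 : inner ℝ (s - (n : ℝ) • G.mean θ) (θ' - θ) ≤ R * (√n * t) := by
    rw [← mul_assoc]
    exact (real_inner_le_norm _ _).trans (by gcongr)
  -- The quadratic branch is `x ^ 2 ≥ L x - L ^ 2`; the linear branch is `√n * x`, for which `L ≤
  -- √n` suffices.
  have h2 : L * (√n * t) - L ^ 2 ≤ n * min (t ^ 2) t := by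
    have hx : 0 ≤ √n * t := by positivity
    have hx1 : n * t ^ 2 = (√n * t) ^ 2 := by rw [mul_pow, hsq]
    have hx2 : n * t = √n * (√n * t) := by rw [← mul_assoc, ← sq, hsq]
    rw [mul_min_of_nonneg _ _ n.cast_nonneg, hx1, hx2]
    refine le_min ?_ ?_
    · nlinarith [sq_nonneg (√n * t - L), mul_nonneg hL0.le hx]
    · nlinarith [mul_nonneg hx (sub_nonneg.2 hLn), sq_nonneg L]
  have h3 := mul_le_mul_of_nonneg_left (hD θ' hθ') (n.cast_nonneg : (0 : ℝ) ≤ n)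
  have h4 := mul_le_mul_of_nonneg_left h2 hc.le
  have h5 : c * (L * (√n * t) - L ^ 2) = 2 * R * (√n * t) - c * L ^ 2 := by
    rw [mul_sub, ← mul_assoc, hcL]
  have h6 : c * (n * min (t ^ 2) t) = n * (c * min (t ^ 2) t) := by ring
  have h7 := hB θ' hθ'
  nlinarith [mul_nonneg hb.le (norm_nonneg θ')]

/-- At distance `1 / √n` a fluctuation of size `R √n` costs at most `R`, `n` times a quadratic
divergence stays bounded, and the prior exponent is continuous. -/
theorem exists_le_posterior_exponent (hΘ : IsOpen G.naturalSpace)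
    (hθ : θ ∈ G.naturalSpace) (τ : EuclideanSpace ℝ (Fin d)) (m : ℝ) {R : ℝ} (hR : 0 < R) :
    ∃ C, ∀ᶠ n : ℕ in atTop, ∀ s, ‖s - (n : ℝ) • G.mean θ‖ ≤ R * √n →
      ∀ θ' ∈ Metric.closedBall θ (√n)⁻¹, θ' ∈ G.naturalSpace ∧
        C ≤ inner ℝ (s - (n : ℝ) • G.mean θ) (θ' - θ) - n * G.divergence θ θ'
          + (inner ℝ τ θ' - m * G.logPartition θ') := by
  obtain ⟨K, hK, δ, hδ, hD⟩ := exists_divergence_le hΘ hθ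
  have hcont : ContinuousAt (fun θ' => inner ℝ τ θ' - m * G.logPartition θ') θ := by
    have := (hasGradientAt_logPartition hΘ hθ).continuousAt
    fun_prop
  obtain ⟨δ', hδ', hball⟩ := Metric.eventually_nhds_iff_ball.1
    (hcont.eventually (lt_mem_nhds (sub_one_lt _)))
  have hlim : Tendsto (fun n : ℕ => (√(n : ℝ))⁻¹) atTop (𝓝 0) :=
    tendsto_inv_atTop_zero.comp (Real.tendsto_sqrt_atTop.comp tendsto_natCast_atTop_atTop)
  refine ⟨-R - K + (inner ℝ τ θ - m * G.logPartition θ - 1), ?_⟩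
  filter_upwards [hlim.eventually_lt_const (lt_min hδ hδ'), eventually_gt_atTop 0]
    with n hn hn0 s hs θ' hθ'
  have hn0' : 0 < √(n : ℝ) := Real.sqrt_pos.2 (Nat.cast_pos.2 hn0)
  have hsq : √(n : ℝ) ^ 2 = n := Real.sq_sqrt n.cast_nonneg
  rw [Metric.mem_closedBall, dist_eq_norm] at hθ'
  obtain ⟨hmem, hle⟩ := hD θ' (hθ'.trans (hn.le.trans (min_le_left _ _)))
  have h1 := hball θ' (by
    rw [Metric.mem_ball, dist_eq_norm]
    exact hθ'.trans_lt (hn.trans_le (min_le_right _ _)))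
  refine ⟨hmem, ?_⟩
  have h2 : |inner ℝ (s - (n : ℝ) • G.mean θ) (θ' - θ)| ≤ R := by
    calc _ ≤ R * √n * (√n)⁻¹ := (abs_real_inner_le_norm _ _).trans (by gcongr)
      _ = R := by field_simp
  have h3 : n * G.divergence θ θ' ≤ K := by
    calc _ ≤ n * (K * (√(n : ℝ))⁻¹ ^ 2) := by
          gcongr
          exact hle.trans (by gcongr)
      _ = K := by rw [inv_pow, hsq]; field_simp
  linarith [neg_le_of_abs_le h2]

/-- Both bounds carry the volume factor `n ^ (-d / 2)`: above, from rescaling the integral of `exp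
(-R ‖v‖)` by `√n`; below, from the volume of a ball of radius `1 / √n`. -/
theorem exists_abs_log_conjugateMass_le (hG : G.IsFullRank) (hΘ : IsOpen G.naturalSpace)
    (hθ : θ ∈ G.naturalSpace) (hm : 0 < m)
    (hτ : m⁻¹ • τ ∈ interior (convexSupport ((G.law θ).map G.T))) {R : ℝ} (hR : 0 < R) :
    ∃ C, ∀ᶠ n : ℕ in atTop, ∀ s, ‖s - (n : ℝ) • G.mean θ‖ ≤ R * √n →
      0 < G.conjugateMass (τ + s) (m + n) ∧
      |Real.log (G.conjugateMass (τ + s) (m + n)) - (inner ℝ s θ - n * G.logPartition θ)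
        + d / 2 * Real.log n| ≤ C := by
  obtain ⟨C₁, hup⟩ := exists_posterior_exponent_le hG hΘ hθ hm hτ hR
  obtain ⟨C₂, hlow⟩ := exists_le_posterior_exponent hΘ hθ τ m hR
  set I : ℝ := ∫ v : EuclideanSpace ℝ (Fin d), Real.exp (-(R * ‖v‖)) with hI
  have hIint := integrable_exp_neg_mul_norm (volume : Measure (EuclideanSpace ℝ (Fin d))) hR
  have hI0 : 0 < I := integral_exp_pos hIint
  set V : ℝ := volume.real (Metric.ball (0 : EuclideanSpace ℝ (Fin d)) 1) with hV
  have hV0 : 0 < V := ENNReal.toReal_pos (Metric.measure_ball_pos _ _ one_pos).ne'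
    measure_ball_lt_top.ne
  refine ⟨max |C₁ + Real.log I| |C₂ + Real.log V|, ?_⟩
  filter_upwards [hup, hlow, eventually_gt_atTop 0] with n hup hlow hn0 s hs
  have hn : (0 : ℝ) < n := Nat.cast_pos.2 hn0
  have hsn : 0 < √(n : ℝ) := Real.sqrt_pos.2 hn
  set a : ℝ := inner ℝ s θ - n * G.logPartition θ
  set ψ : EuclideanSpace ℝ (Fin d) → ℝ := fun θ' =>
    inner ℝ (τ + s) θ' - (m + n) * G.logPartition θ' with hψ
  have hψup : ∀ θ' ∈ G.naturalSpace, ψ θ' ≤ a + (C₁ - R * (√n * ‖θ' - θ‖)) := fun θ' hθ' => by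
    rw [hψ]
    simp only
    rw [posterior_exponent_eq θ]
    linarith [hup s hs θ' hθ']
  have hψlow : ∀ θ' ∈ Metric.closedBall θ (√n)⁻¹, a + C₂ ≤ ψ θ' := fun θ' hθ' => by
    rw [hψ]
    simp only
    rw [posterior_exponent_eq θ]
    linarith [(hlow s hs θ' hθ').2]
  have hdom : Integrable (fun θ' : EuclideanSpace ℝ (Fin d) =>
      Real.exp (a + C₁) * Real.exp (-(R * ‖√(n : ℝ) • (θ' - θ)‖))) :=
    ((hIint.comp_smul hsn.ne').comp_sub_right θ).const_mul _
  have hdomI : ∫ θ' : EuclideanSpace ℝ (Fin d),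
      Real.exp (a + C₁) * Real.exp (-(R * ‖√(n : ℝ) • (θ' - θ)‖)) =
      Real.exp (a + C₁) * ((√n ^ d)⁻¹ * I) := by
    rw [integral_const_mul, integral_sub_right_eq_self
      (fun v : EuclideanSpace ℝ (Fin d) => Real.exp (-(R * ‖√(n : ℝ) • v‖))) θ,
      Measure.integral_comp_smul volume
        (fun v : EuclideanSpace ℝ (Fin d) => Real.exp (-(R * ‖v‖))), finrank_euclideanSpace,
      Fintype.card_fin, abs_of_nonneg (by positivity), smul_eq_mul]
  have hle : ∀ θ' ∈ G.naturalSpace, Real.exp (ψ θ') ≤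
      Real.exp (a + C₁) * Real.exp (-(R * ‖√(n : ℝ) • (θ' - θ)‖)) := fun θ' hθ' => by
    rw [← Real.exp_add, Real.exp_le_exp, norm_smul, Real.norm_of_nonneg hsn.le]
    linarith [hψup θ' hθ']
  have hint : IntegrableOn (fun θ' => Real.exp (ψ θ')) G.naturalSpace := by
    refine hdom.integrableOn.mono'
      ((continuousOn_exp_conjugate hΘ _ _).aestronglyMeasurable hΘ.measurableSet) ?_
    filter_upwards [ae_restrict_mem hΘ.measurableSet] with θ' hθ'
    rw [Real.norm_of_nonneg (Real.exp_pos _).le]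
    exact hle θ' hθ'
  have hpos := conjugateMass_pos_of_integrableOn hΘ hθ hint
  have hupper : G.conjugateMass (τ + s) (m + n) ≤ Real.exp (a + C₁) * ((√n ^ d)⁻¹ * I) := by
    rw [← hdomI]
    exact (setIntegral_mono_on hint hdom.integrableOn hΘ.measurableSet hle).trans
      (setIntegral_le_integral hdom (ae_of_all _ fun θ' => by positivity))
  have hvol : volume.real (Metric.closedBall θ (√(n : ℝ))⁻¹) = (√n ^ d)⁻¹ * V := by
    rw [measureReal_def, Measure.addHaar_closedBall _ _ (by positivity), ENNReal.toReal_mul,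
      ENNReal.toReal_ofReal (by positivity), finrank_euclideanSpace, Fintype.card_fin, inv_pow]
    rfl
  have hlower : Real.exp (a + C₂) * ((√n ^ d)⁻¹ * V) ≤ G.conjugateMass (τ + s) (m + n) := by
    have hsub : Metric.closedBall θ (√(n : ℝ))⁻¹ ⊆ G.naturalSpace := fun θ' hθ' =>
      (hlow s hs θ' hθ').1
    calc _ = ∫ _ in Metric.closedBall θ (√(n : ℝ))⁻¹, Real.exp (a + C₂) := by
          rw [setIntegral_const, hvol, smul_eq_mul, mul_comm]
      _ ≤ ∫ θ' in Metric.closedBall θ (√(n : ℝ))⁻¹, Real.exp (ψ θ') :=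
          setIntegral_mono_on (integrableOn_const measure_closedBall_lt_top.ne)
            (hint.mono_set hsub) measurableSet_closedBall
            fun θ' hθ' => Real.exp_le_exp.2 (hψlow θ' hθ')
      _ ≤ _ := setIntegral_mono_set hint (ae_of_all _ fun _ => (Real.exp_pos _).le)
          hsub.eventuallyLE
  have hlog : ∀ c W : ℝ, 0 < W → Real.log (Real.exp c * ((√(n : ℝ) ^ d)⁻¹ * W)) =
      c - d / 2 * Real.log n + Real.log W := fun c W hW => by
    rw [Real.log_mul (by positivity) (by positivity), Real.log_mul (by positivity) hW.ne',
      Real.log_exp, Real.log_inv, Real.log_pow, Real.log_sqrt hn.le]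
    ring
  have hl1 := Real.log_le_log hpos hupper
  have hl2 := Real.log_le_log (by positivity) hlower
  rw [hlog _ _ hI0] at hl1
  rw [hlog _ _ hV0] at hl2
  refine ⟨hpos, abs_le.2 ⟨?_, ?_⟩⟩
  · linarith [le_max_right |C₁ + Real.log I| |C₂ + Real.log V|, neg_abs_le (C₂ + Real.log V)]
  · linarith [le_max_left |C₁ + Real.log I| |C₂ + Real.log V|, le_abs_self (C₁ + Real.log I)]

end ExpFamily

/-! ### Tightness of centred sums and convergence in probability. -/

section Probability

variable {𝒳 Ω : Type*} [MeasurableSpace 𝒳] [MeasurableSpace Ω] {P : Measure Ω} {ρ : Measure 𝒳}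

theorem ProbabilityTheory.HasLaw.integrable_comp {E : Type*} [NormedAddCommGroup E]
    {X : Ω → 𝒳} (hX : HasLaw X ρ P) {f : 𝒳 → E} (hf : Integrable f ρ) :
    Integrable (fun ω => f (X ω)) P := by
  rw [← hX.map_eq] at hf
  exact hf.comp_aemeasurable hX.aemeasurable

/-- Additivity of variance, applied to each coordinate and summed. -/
theorem integral_norm_sq_sum_of_iIndepFun [IsProbabilityMeasure P] {d : ℕ}
    {Y : 𝒳 → EuclideanSpace ℝ (Fin d)} (hY : Measurable Y) (hYi : Integrable Y ρ)
    (hsq : Integrable (fun x => ‖Y x‖ ^ 2) ρ) (hmean : ∫ x, Y x ∂ρ = 0)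
    {X : ℕ → Ω → 𝒳} (hX : ∀ i, HasLaw (X i) ρ P) (hindep : iIndepFun X P) (n : ℕ) :
    Integrable (fun ω => ‖∑ i ∈ Finset.range n, Y (X i ω)‖ ^ 2) P ∧
      ∫ ω, ‖∑ i ∈ Finset.range n, Y (X i ω)‖ ^ 2 ∂P = n * ∫ x, ‖Y x‖ ^ 2 ∂ρ := by
  have hYm : ∀ j, Measurable fun x => Y x j := fun j => by fun_prop
  have hYj : ∀ j, Integrable (fun x => Y x j) ρ := fun j =>
    (EuclideanSpace.proj (𝕜 := ℝ) j).integrable_comp hYi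
  have hYj0 : ∀ j, ∫ x, Y x j ∂ρ = 0 := fun j => by
    have := (EuclideanSpace.proj (𝕜 := ℝ) j).integral_comp_comm hYi
    rw [hmean, map_zero] at this
    exact this
  have hYsq : ∀ j, Integrable (fun x => Y x j ^ 2) ρ := fun j => by
    refine hsq.mono' (by fun_prop) (ae_of_all _ fun x => ?_)
    rw [Real.norm_of_nonneg (sq_nonneg _), EuclideanSpace.real_norm_sq_eq]
    exact Finset.single_le_sum (f := fun j => Y x j ^ 2) (fun i _ => sq_nonneg _)
      (Finset.mem_univ j)
  have hmem : ∀ j i, MemLp (fun ω => Y (X i ω) j) 2 P := fun j i =>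
    (memLp_two_iff_integrable_sq ((hX i).integrable_comp (hYj j)).aestronglyMeasurable).2
      ((hX i).integrable_comp (hYsq j))
  have hW0 : ∀ j i, ∫ ω, Y (X i ω) j ∂P = 0 := fun j i =>
    ((hX i).integral_comp (hYj j).aestronglyMeasurable).trans (hYj0 j)
  have hWsq : ∀ j i, ∫ ω, Y (X i ω) j ^ 2 ∂P = ∫ x, Y x j ^ 2 ∂ρ := fun j i =>
    (hX i).integral_comp (hYsq j).aestronglyMeasurable
  have hSm : ∀ j, MemLp (∑ i ∈ Finset.range n, fun ω => Y (X i ω) j) 2 P := fun j =>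
    memLp_finsetSum' _ fun i _ => hmem j i
  have hS : ∀ j, ∫ ω, (∑ i ∈ Finset.range n, Y (X i ω) j) ^ 2 ∂P = n * ∫ x, Y x j ^ 2 ∂ρ := by
    intro j
    have hvar := IndepFun.variance_sum (μ := P) (X := fun i ω => Y (X i ω) j)
      (s := Finset.range n) (fun i _ => hmem j i) (fun i _ i' _ hne =>
        (hindep.indepFun hne).comp (hYm j) (hYm j))
    rw [variance_of_integral_eq_zero (hSm j).aestronglyMeasurable.aemeasurable] at hvar
    · simp only [Finset.sum_apply] at hvar
      rw [hvar, Finset.sum_congr rfl fun i _ => by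
        rw [variance_of_integral_eq_zero (hmem j i).aestronglyMeasurable.aemeasurable (hW0 j i),
          hWsq j i]]
      simp
    · simp only [Finset.sum_apply]
      rw [integral_finsetSum _ fun i _ => (hmem j i).integrable one_le_two]
      simp [hW0]
  have hnorm : ∀ ω, ‖∑ i ∈ Finset.range n, Y (X i ω)‖ ^ 2 =
      ∑ j, (∑ i ∈ Finset.range n, Y (X i ω) j) ^ 2 := fun ω => by
    simp [EuclideanSpace.real_norm_sq_eq]
  have hSi : ∀ j, Integrable (fun ω => (∑ i ∈ Finset.range n, Y (X i ω) j) ^ 2) P := fun j => by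
    simpa using (hSm j).integrable_sq
  simp only [hnorm]
  refine ⟨integrable_finsetSum _ fun j _ => hSi j, ?_⟩
  rw [integral_finsetSum _ fun j _ => hSi j]
  simp only [hS, EuclideanSpace.real_norm_sq_eq]
  rw [integral_finsetSum _ fun j _ => hYsq j, Finset.mul_sum]

theorem measure_lt_norm_sum_le_of_iIndepFun [IsProbabilityMeasure P] {d : ℕ}
    {Y : 𝒳 → EuclideanSpace ℝ (Fin d)} (hY : Measurable Y) (hYi : Integrable Y ρ)
    (hsq : Integrable (fun x => ‖Y x‖ ^ 2) ρ) (hmean : ∫ x, Y x ∂ρ = 0)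
    {X : ℕ → Ω → 𝒳} (hX : ∀ i, HasLaw (X i) ρ P) (hindep : iIndepFun X P) (n : ℕ)
    {R : ℝ} (hR : 0 < R) :
    P {ω | R * √n < ‖∑ i ∈ Finset.range n, Y (X i ω)‖} ≤
      ENNReal.ofReal ((∫ x, ‖Y x‖ ^ 2 ∂ρ) / R ^ 2) := by
  obtain ⟨hint, hI⟩ := integral_norm_sq_sum_of_iIndepFun hY hYi hsq hmean hX hindep n
  rcases Nat.eq_zero_or_pos n with rfl | hn
  · simp
  have hn' : (0 : ℝ) < n := Nat.cast_pos.2 hn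
  have h1 := mul_meas_ge_le_integral_of_nonneg (ae_of_all _ fun ω => sq_nonneg _) hint (R ^ 2 * n)
  rw [hI] at h1
  refine (ENNReal.le_ofReal_iff_toReal_le (measure_ne_top _ _)
    (div_nonneg (integral_nonneg fun x => sq_nonneg _) (sq_nonneg _))).2 ?_
  rw [le_div_iff₀ (by positivity)]
  have h2 : P.real {ω | R * √n < ‖∑ i ∈ Finset.range n, Y (X i ω)‖} ≤
      P.real {ω | R ^ 2 * n ≤ ‖∑ i ∈ Finset.range n, Y (X i ω)‖ ^ 2} := by
    refine measureReal_mono fun ω hω => ?_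
    rw [Set.mem_ofPred_eq] at hω ⊢
    have h3 : (R * √n) ^ 2 ≤ ‖∑ i ∈ Finset.range n, Y (X i ω)‖ ^ 2 := by gcongr
    rwa [mul_pow, Real.sq_sqrt hn'.le] at h3
  change P.real _ * _ ≤ _
  have h4 : n * (P.real {ω | R ^ 2 * n ≤ ‖∑ i ∈ Finset.range n, Y (X i ω)‖ ^ 2} * R ^ 2) ≤
      n * ∫ x, ‖Y x‖ ^ 2 ∂ρ := by linarith
  exact (mul_le_mul_of_nonneg_right h2 (sq_nonneg R)).trans (le_of_mul_le_mul_left h4 hn')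

/-- The exceptional event is made small by the choice of `R` alone, uniformly in `n`; off it only an
almost sure estimate at fixed `R` is left to prove. -/
theorem tendstoInMeasure_const_of_tight {S : ℕ → Ω → ℝ} {V : ℝ}
    (hS : ∀ (n : ℕ) (R : ℝ), 0 < R → P {ω | R * √n < S n ω} ≤ ENNReal.ofReal (V / R ^ 2))
    {f : ℕ → Ω → ℝ} {c : ℝ}
    (hf : ∀ R > 0, ∀ ε > 0, ∀ᶠ n : ℕ in atTop, ∀ᵐ ω ∂P, S n ω ≤ R * √n → |f n ω - c| < ε) :
    TendstoInMeasure P f atTop fun _ => c := by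
  rw [tendstoInMeasure_iff_norm]
  intro ε hε
  rw [ENNReal.tendsto_nhds_zero]
  intro η hη
  have hlim : Tendsto (fun R : ℝ => ENNReal.ofReal (V / R ^ 2)) atTop (𝓝 0) := by
    have := ENNReal.tendsto_ofReal ((tendsto_const_nhds (x := V)).div_atTop
      (tendsto_pow_atTop (α := ℝ) two_ne_zero))
    simpa using this
  obtain ⟨R, hRη, hR⟩ := ((hlim.eventually_le_const hη).and (eventually_gt_atTop 0)).exists
  filter_upwards [hf R hR ε hε] with n hn
  refine (measure_mono_ae ?_).trans ((hS n R hR).trans hRη)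
  filter_upwards [hn] with ω hω hmem
  change R * √n < S n ω
  by_contra hlt
  exact absurd (hω (not_lt.1 hlt)) (not_lt.2 hmem)

end Probability

/-! ### Matching means in the nested model, and the Bayes factor. -/

namespace ExpFamily

variable {𝒳 : Type*} [MeasurableSpace 𝒳] {k l : ℕ}

theorem mem_naturalSpace_of_integrable_exp_inner {G : ExpFamily 𝒳 k}
    {θ θ' : EuclideanSpace ℝ (Fin k)} (hθ : θ ∈ G.naturalSpace)
    (h : Integrable (fun x => Real.exp (inner ℝ (θ' - θ) (G.T x))) (G.law θ)) :
    θ' ∈ G.naturalSpace := by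
  have := G.isProbabilityMeasure_law hθ
  have hpos := integral_exp_pos h
  rw [integral_law] at hpos
  rw [integrable_law_iff] at h
  simp only [density_mul_exp_inner] at h hpos
  rw [integral_const_mul] at hpos
  exact ⟨(integrable_const_mul_iff (Real.exp_pos _).ne'.isUnit _).1 h,
    pos_of_mul_pos_right hpos (Real.exp_pos _).le⟩

/-- Fatou's lemma for the exponential moments. Closedness is in the whole space, so a minimizing
sequence cannot escape through the boundary of the parameter space. -/
theorem isClosed_divergence_le {G : ExpFamily 𝒳 k} {θ : EuclideanSpace ℝ (Fin k)}
    (hθ : θ ∈ G.naturalSpace) (B : ℝ) :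
    IsClosed {θ' | θ' ∈ G.naturalSpace ∧ G.divergence θ θ' ≤ B} := by
  refine IsSeqClosed.isClosed fun u θ' hu hlim => ?_
  -- Extended nonnegative values, because integrability at the limit point is part of what must be
  -- shown.
  set f : EuclideanSpace ℝ (Fin k) → 𝒳 → ℝ≥0∞ := fun θ' x =>
    ENNReal.ofReal (Real.exp (inner ℝ (θ' - θ) (G.T x - G.mean θ))) with hf
  have hmeas : ∀ θ', Measurable fun x => Real.exp (inner ℝ (θ' - θ) (G.T x - G.mean θ)) :=
    fun θ' => ((G.measurable_T.sub_const _).const_inner).exp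
  have hbd : ∀ j, ∫⁻ x, f (u j) x ∂(G.law θ) ≤ ENNReal.ofReal (Real.exp B) := fun j => by
    rw [hf, ← ofReal_integral_eq_lintegral_ofReal (G.integrable_exp_inner_sub_law θ _ (hu j).1)
      (ae_of_all _ fun x => (Real.exp_pos _).le), ← G.exp_divergence θ (hu j).1]
    exact ENNReal.ofReal_le_ofReal (Real.exp_le_exp.2 (hu j).2)
  have hfatou : ∫⁻ x, f θ' x ∂(G.law θ) ≤ ENNReal.ofReal (Real.exp B) := by
    have h1 : ∀ x, liminf (fun j => f (u j) x) atTop = f θ' x := fun x => by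
      have hc : Continuous fun θ' => f θ' x := ENNReal.continuous_ofReal.comp (by fun_prop)
      exact ((hc.tendsto θ').comp hlim).liminf_eq
    have h2 := lintegral_liminf_le (μ := G.law θ) (u := atTop) (f := fun j => f (u j))
      fun j => (hmeas (u j)).ennreal_ofReal
    calc _ = ∫⁻ x, liminf (fun j => f (u j) x) atTop ∂(G.law θ) := by simp only [h1]
      _ ≤ _ := h2
      _ ≤ _ := liminf_le_of_le (by isBoundedDefault) fun b hb => by
        obtain ⟨j, hj⟩ := hb.exists
        exact hj.trans (hbd j)
  have hint : Integrable (fun x => Real.exp (inner ℝ (θ' - θ) (G.T x - G.mean θ))) (G.law θ) := by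
    refine ⟨(hmeas θ').aestronglyMeasurable, ?_⟩
    rw [hasFiniteIntegral_iff_ofReal (ae_of_all _ fun x => (Real.exp_pos _).le)]
    exact hfatou.trans_lt ENNReal.ofReal_lt_top
  have hmem : θ' ∈ G.naturalSpace := by
    refine mem_naturalSpace_of_integrable_exp_inner hθ ?_
    simp only [exp_inner_sub] at hint
    exact (integrable_const_mul_iff (Real.exp_pos _).ne'.isUnit _).1 hint
  refine ⟨hmem, ?_⟩
  rw [← Real.exp_le_exp, G.exp_divergence θ hmem,
    ← ENNReal.ofReal_le_ofReal_iff (Real.exp_pos _).le,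
    ofReal_integral_eq_lintegral_ofReal hint (ae_of_all _ fun x => (Real.exp_pos _).le)]
  exact hfatou

section Nested

variable {F : ExpFamily 𝒳 k} {M : Matrix (Fin l) (Fin k) ℝ}

theorem inner_toEuclideanLin_transpose (M : Matrix (Fin l) (Fin k) ℝ)
    (η : EuclideanSpace ℝ (Fin l)) (t : EuclideanSpace ℝ (Fin k)) :
    inner ℝ (M.transpose.toEuclideanLin η) t = inner ℝ η (M.toEuclideanLin t) := by
  rw [← Matrix.conjTranspose_eq_transpose_of_trivial,
    Matrix.toEuclideanLin_conjTranspose_eq_adjoint, LinearMap.adjoint_inner_left]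

theorem injective_toEuclideanLin_transpose (hM : M.rank = l) :
    Function.Injective M.transpose.toEuclideanLin := by
  have h1 : LinearIndependent ℝ M.row := by
    rw [linearIndependent_iff_card_eq_finrank_span, Fintype.card_fin, Set.finrank,
      ← Matrix.rank_eq_finrank_span_row, hM]
  have h2 : Function.Injective M.transpose.mulVec := Matrix.mulVec_injective_iff.2 h1
  intro η η' h
  exact WithLp.ofLp_injective 2 (h2 (WithLp.toLp_injective 2 h))

theorem law_nested (F : ExpFamily 𝒳 k) (M : Matrix (Fin l) (Fin k) ℝ)
    (η : EuclideanSpace ℝ (Fin l)) :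
    (F.nested M).law η = F.law (M.transpose.toEuclideanLin η) := by
  unfold law
  simp only [density_nested]
  rfl

theorem mean_nested (hΘ : IsOpen F.naturalSpace) {η : EuclideanSpace ℝ (Fin l)}
    (hη : η ∈ (F.nested M).naturalSpace) :
    (F.nested M).mean η = M.toEuclideanLin (F.mean (M.transpose.toEuclideanLin η)) := by
  rw [naturalSpace_nested] at hη
  rw [mean, mean, law_nested]
  exact (LinearMap.toContinuousLinearMap M.toEuclideanLin).integral_comp_comm
    (integrable_T hΘ hη)

theorem isFullRank_nested (hF : F.IsFullRank) (hM : M.rank = l) : (F.nested M).IsFullRank := by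
  intro η hη c b hc
  rw [naturalSpace_nested] at hη
  rw [law_nested] at hc
  simp only [inner_nested_T] at hc
  exact (map_eq_zero_iff _ (injective_toEuclideanLin_transpose hM)).1 (hF _ hη _ b hc)

/-- Up to a constant, the divergence along the submodel is the function of `η` whose critical points
are the solutions of the mean equation. -/
theorem divergence_transpose (F : ExpFamily 𝒳 k) (M : Matrix (Fin l) (Fin k) ℝ)
    (θ : EuclideanSpace ℝ (Fin k)) (η : EuclideanSpace ℝ (Fin l)) :
    F.divergence θ (M.transpose.toEuclideanLin η) =
      (F.nested M).logPartition η - inner ℝ (M.toEuclideanLin (F.mean θ)) η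
        + (inner ℝ (F.mean θ) θ - F.logPartition θ) := by
  rw [divergence, logPartition_nested, inner_sub_right,
    real_inner_comm (M.transpose.toEuclideanLin η), inner_toEuclideanLin_transpose,
    real_inner_comm (M.toEuclideanLin _)]
  ring

theorem exists_mean_nested_eq (hF : F.IsFullRank) (hM : M.rank = l) (hΘ : IsOpen F.naturalSpace)
    (hE : IsOpen (F.nested M).naturalSpace) (hE_ne : (F.nested M).naturalSpace.Nonempty)
    {θ : EuclideanSpace ℝ (Fin k)} (hθ : θ ∈ F.naturalSpace) :
    ∃ η ∈ (F.nested M).naturalSpace, (F.nested M).mean η = M.toEuclideanLin (F.mean θ) := by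
  obtain ⟨η₁, hη₁⟩ := hE_ne
  set N := M.transpose.toEuclideanLin
  have hNc : Continuous N := N.continuous_of_finiteDimensional
  set B := F.divergence θ (N η₁)
  set S : Set (EuclideanSpace ℝ (Fin l)) :=
    N ⁻¹' {θ' | θ' ∈ F.naturalSpace ∧ F.divergence θ θ' ≤ B} with hS
  have hSE : S ⊆ (F.nested M).naturalSpace := fun η hη => by
    rw [naturalSpace_nested]
    exact hη.1
  have hE_mem : ∀ η ∈ (F.nested M).naturalSpace, N η ∈ F.naturalSpace := fun η hη => by
    rwa [naturalSpace_nested] at hη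
  have hη₁S : η₁ ∈ S := ⟨hE_mem η₁ hη₁, le_rfl⟩
  have hcompact : IsCompact S := by
    refine Metric.isCompact_of_isClosed_isBounded ((isClosed_divergence_le hθ B).preimage hNc) ?_
    obtain ⟨K, -, hK⟩ := (LinearMap.injective_iff_antilipschitz N).1
      (injective_toEuclideanLin_transpose hM)
    refine hK.isBounded_preimage ?_
    obtain ⟨c, hc, hD⟩ := exists_le_divergence hF hΘ hθ
    -- Beyond distance `1` the lower bound for the divergence is linear with slope `c`, and it
    -- exceeds `B` beyond `B / c`.
    refine (Metric.isBounded_closedBall (x := θ) (r := max 1 (B / c))).subset fun θ' hθ' => ?_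
    rw [Metric.mem_closedBall, dist_eq_norm]
    by_contra hlt
    push Not at hlt
    obtain ⟨h1, h2⟩ := max_lt_iff.1 hlt
    have h3 := (hD θ' hθ'.1).trans hθ'.2
    rw [min_eq_right (by nlinarith)] at h3
    rw [div_lt_iff₀ hc] at h2
    linarith
  have hcont : ContinuousOn (fun η => (F.nested M).logPartition η
      - inner ℝ (M.toEuclideanLin (F.mean θ)) η) (F.nested M).naturalSpace :=
    (continuousOn_logPartition hE).sub (by fun_prop)
  obtain ⟨η₀, hη₀, hmin⟩ := hcompact.exists_isMinOn ⟨η₁, hη₁S⟩ (hcont.mono hSE)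
  refine ⟨η₀, hSE hη₀, ?_⟩
  -- Outside `S` the divergence exceeds `B`, so the minimum over `S` is one over the whole open
  -- parameter space and the gradient vanishes there.
  have hlocal : IsLocalMin (fun η => (F.nested M).logPartition η
      - inner ℝ (M.toEuclideanLin (F.mean θ)) η) η₀ := by
    filter_upwards [hE.mem_nhds (hSE hη₀)] with η hη
    by_cases hηS : η ∈ S
    · exact hmin hηS
    · have h1 : B < F.divergence θ (N η) := by
        by_contra hle
        exact hηS ⟨hE_mem η hη, not_lt.1 hle⟩
      have h2 := hη₀.2.trans h1.le
      rw [divergence_transpose, divergence_transpose] at h2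
      linarith
  have hderiv : HasFDerivAt (fun η => (F.nested M).logPartition η
      - inner ℝ (M.toEuclideanLin (F.mean θ)) η)
      (InnerProductSpace.toDual ℝ _ ((F.nested M).mean η₀)
        - InnerProductSpace.toDual ℝ _ (M.toEuclideanLin (F.mean θ))) η₀ :=
    (hasGradientAt_logPartition hE (hSE hη₀)).hasFDerivAt.sub
      (InnerProductSpace.toDual ℝ _ (M.toEuclideanLin (F.mean θ))).hasFDerivAt
  have hzero := hlocal.hasFDerivAt_eq_zero hderiv
  exact (InnerProductSpace.toDual ℝ _).injective (sub_eq_zero.1 hzero)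

/-- The log Bayes factor, up to a bounded error, on the event that the sufficient statistic is
within `R √n` of its mean. -/
theorem exists_abs_log_evidence_ratio_le (hF : F.IsFullRank) (hM : M.rank = l)
    (hΘ : IsOpen F.naturalSpace) (hE : IsOpen (F.nested M).naturalSpace)
    {θ : EuclideanSpace ℝ (Fin k)} (hθ : θ ∈ F.naturalSpace)
    {m w : ℝ} (hm : 0 < m) (hw : 0 < w)
    {τ : EuclideanSpace ℝ (Fin k)} {υ : EuclideanSpace ℝ (Fin l)}
    (hτ : m⁻¹ • τ ∈ interior (convexSupport ((F.law θ).map F.T)))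
    (hυ : w⁻¹ • υ ∈ interior
      (convexSupport ((F.law θ).map fun x => M.toEuclideanLin (F.T x))))
    {η : EuclideanSpace ℝ (Fin l)} (hη : η ∈ (F.nested M).naturalSpace)
    (hmean : (F.nested M).mean η = M.toEuclideanLin (F.mean θ)) {R : ℝ} (hR : 0 < R) :
    ∃ C, ∀ᶠ n : ℕ in atTop, ∀ x : ℕ → 𝒳, (∀ i, 0 < F.h (x i)) →
      ‖∑ i ∈ Finset.range n, (F.T (x i) - F.mean θ)‖ ≤ R * √n →
      |Real.log (F.evidence τ m n x / (F.nested M).evidence υ w n x)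
        - (inner ℝ (∑ i ∈ Finset.range n, F.T (x i)) (θ - M.transpose.toEuclideanLin η)
          - n * (F.logPartition θ - F.logPartition (M.transpose.toEuclideanLin η)))
        + ((k : ℝ) - l) / 2 * Real.log n| ≤ C := by
  -- The support condition is given under the true law but needed under the member at `η`, which has
  -- the same null sets.
  have hυ' : w⁻¹ • υ ∈ interior
      (convexSupport (((F.nested M).law η).map (F.nested M).T)) := by
    rw [law_nested]
    exact interior_mono (convexSupport_map_subset_of_absolutelyContinuous
      (F.law_absolutelyContinuous _ _) (F.nested M).measurable_T) hυ
  set L := LinearMap.toContinuousLinearMap M.toEuclideanLin with hL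
  -- Adding `1` keeps the radius positive even if `L = 0`.
  have hR' : 0 < (‖L‖ + 1) * R := by positivity
  obtain ⟨C₁, h₁⟩ := exists_abs_log_conjugateMass_le hF hΘ hθ hm hτ hR
  obtain ⟨C₂, h₂⟩ := exists_abs_log_conjugateMass_le (isFullRank_nested hF hM) hE hη hw hυ' hR'
  have hp₁ := conjugateMass_pos hΘ hθ hm hτ
  have hp₂ := conjugateMass_pos hE hη hw hυ'
  refine ⟨C₁ + C₂ + |Real.log (F.conjugateMass τ m)
    - Real.log ((F.nested M).conjugateMass υ w)|, ?_⟩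
  filter_upwards [h₁, h₂] with n h₁ h₂ x hx hs
  set s := ∑ i ∈ Finset.range n, F.T (x i)
  have hs' : ‖s - (n : ℝ) • F.mean θ‖ ≤ R * √n := by
    simpa [Finset.sum_sub_distrib, Nat.cast_smul_eq_nsmul] using hs
  have hMs : ∑ i ∈ Finset.range n, (F.nested M).T (x i) = L s := by
    rw [map_sum]; rfl
  have hLs : ‖L s - (n : ℝ) • (F.nested M).mean η‖ ≤ (‖L‖ + 1) * R * √n := by
    have h : L s - (n : ℝ) • (F.nested M).mean η = L (s - (n : ℝ) • F.mean θ) := by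
      rw [hmean, map_sub, map_smul]; rfl
    rw [h, mul_assoc]
    calc _ ≤ ‖L‖ * (R * √n) := (L.le_opNorm _).trans (by gcongr)
      _ ≤ _ := by gcongr; linarith
  obtain ⟨hq₁, hb₁⟩ := h₁ s hs'
  obtain ⟨hq₂, hb₂⟩ := h₂ (L s) hLs
  have hprod : 0 < ∏ i ∈ Finset.range n, F.h (x i) := Finset.prod_pos fun i _ => hx i
  have hratio : F.evidence τ m n x / (F.nested M).evidence υ w n x =
      (F.conjugateMass (τ + s) (m + n) / F.conjugateMass τ m) /
        ((F.nested M).conjugateMass (υ + L s) (w + n) / (F.nested M).conjugateMass υ w) := by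
    rw [evidence_eq, evidence_eq, hMs]
    change (∏ i ∈ Finset.range n, F.h (x i)) * _ * _ / ((∏ i ∈ Finset.range n, F.h (x i)) * _ * _)
      = _
    rw [mul_assoc, mul_assoc, mul_div_mul_left _ _ hprod.ne', inv_mul_eq_div, inv_mul_eq_div]
  rw [hratio, Real.log_div (by positivity) (by positivity), Real.log_div hq₁.ne' hp₁.ne',
    Real.log_div hq₂.ne' hp₂.ne']
  have hinner : inner ℝ s (M.transpose.toEuclideanLin η) = inner ℝ (L s) η := by
    rw [real_inner_comm, inner_toEuclideanLin_transpose, real_inner_comm]; rfl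
  rw [logPartition_nested] at hb₂
  rw [inner_sub_right, hinner]
  have ha := abs_le.1 hb₁
  have hb := abs_le.1 hb₂
  have hc := neg_abs_le (Real.log (F.conjugateMass τ m)
    - Real.log ((F.nested M).conjugateMass υ w))
  have hd := le_abs_self (Real.log (F.conjugateMass τ m)
    - Real.log ((F.nested M).conjugateMass υ w))
  rw [abs_le]
  constructor <;> linarith [ha.1, ha.2, hb.1, hb.2]

end Nested

end ExpFamily

/-! ### The two limits. -/

theorem theorem2 {𝒳 : Type*} [MeasurableSpace 𝒳] {k l : ℕ} (hlk : l < k)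
    (F : ExpFamily 𝒳 k) (hF : F.IsFullRank)
    (M : Matrix (Fin l) (Fin k) ℝ) (hM : M.rank = l)
    (hΘ : IsOpen F.naturalSpace)
    (hE : IsOpen (F.nested M).naturalSpace) (hE_ne : (F.nested M).naturalSpace.Nonempty)
    (θ₀ : EuclideanSpace ℝ (Fin k)) (hθ₀ : θ₀ ∈ F.naturalSpace)
    (m w : ℝ) (hm : 0 < m) (hw : 0 < w)
    (τ : EuclideanSpace ℝ (Fin k)) (υ : EuclideanSpace ℝ (Fin l))
    (hτ : m⁻¹ • τ ∈ interior (convexSupport ((F.law θ₀).map F.T)))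
    (hυ : w⁻¹ • υ ∈ interior
      (convexSupport ((F.law θ₀).map fun x => M.toEuclideanLin (F.T x))))
    {Ω : Type*} [MeasurableSpace Ω] (P : Measure Ω) [IsProbabilityMeasure P]
    (X : ℕ → Ω → 𝒳) (hX_law : ∀ i, HasLaw (X i) (F.law θ₀) P) (hX_indep : iIndepFun X P) :
    (θ₀ ∉ M.transpose.toEuclideanLin '' (F.nested M).naturalSpace →
      ∃ η₀ ∈ (F.nested M).naturalSpace,
        gradient (F.nested M).logPartition η₀
          = M.toEuclideanLin (gradient F.logPartition θ₀) ∧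
        (∀ η ∈ (F.nested M).naturalSpace,
          gradient (F.nested M).logPartition η
            = M.toEuclideanLin (gradient F.logPartition θ₀) → η = η₀) ∧
        TendstoInMeasure P
          (fun (n : ℕ) ω => (n : ℝ)⁻¹ * Real.log
            (F.evidence τ m n (fun i => X i ω) / (F.nested M).evidence υ w n (fun i => X i ω)))
          atTop
          (fun _ => inner ℝ (θ₀ - M.transpose.toEuclideanLin η₀) (gradient F.logPartition θ₀)
            - (F.logPartition θ₀ - F.logPartition (M.transpose.toEuclideanLin η₀))) ∧
        0 < inner ℝ (θ₀ - M.transpose.toEuclideanLin η₀) (gradient F.logPartition θ₀)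
            - (F.logPartition θ₀ - F.logPartition (M.transpose.toEuclideanLin η₀))) ∧
    (θ₀ ∈ M.transpose.toEuclideanLin '' (F.nested M).naturalSpace →
      TendstoInMeasure P
        (fun (n : ℕ) ω => (Real.log n)⁻¹ * Real.log
          (F.evidence τ m n (fun i => X i ω) / (F.nested M).evidence υ w n (fun i => X i ω)))
        atTop (fun _ => -((k : ℝ) - (l : ℝ)) / 2) ∧
      -((k : ℝ) - (l : ℝ)) / 2 < 0) := by
  have hX_tight : ∀ (n : ℕ) (R : ℝ), 0 < R →
      P {ω | R * √n < ‖∑ i ∈ Finset.range n, (F.T (X i ω) - F.mean θ₀)‖} ≤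
        ENNReal.ofReal ((∫ x, ‖F.T x - F.mean θ₀‖ ^ 2 ∂(F.law θ₀)) / R ^ 2) := fun n R hR =>
    measure_lt_norm_sum_le_of_iIndepFun (F.measurable_T.sub_const _)
      (ExpFamily.integrable_T_sub hΘ hθ₀ _) (ExpFamily.integrable_norm_sq_sub hΘ hθ₀ _)
      (ExpFamily.integral_T_sub_mean hΘ hθ₀) hX_law hX_indep n hR
  -- Needed to cancel the product of carrier values in the Bayes factor.
  have hX_pos : ∀ᵐ ω ∂P, ∀ i, 0 < F.h (X i ω) := ae_all_iff.2 fun i =>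
    ((hX_law i).ae_iff (measurable_const.lt F.measurable_h)).2 (F.ae_h_pos θ₀)
  have hN := ExpFamily.isFullRank_nested hF hM
  refine ⟨fun hnot => ?_, fun hmem => ⟨?_, ?_⟩⟩
  · obtain ⟨η₀, hη₀, hmean⟩ := ExpFamily.exists_mean_nested_eq hF hM hΘ hE hE_ne hθ₀
    rw [ExpFamily.gradient_logPartition hΘ hθ₀]
    refine ⟨η₀, hη₀, (ExpFamily.gradient_logPartition hE hη₀).trans hmean, fun η hη h => ?_, ?_, ?_⟩
    · rw [ExpFamily.gradient_logPartition hE hη, ← hmean] at h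
      exact ExpFamily.eq_of_mean_eq hN hE hη₀ hη h
    · refine tendstoInMeasure_const_of_tight hX_tight fun R hR ε hε => ?_
      obtain ⟨C, hC⟩ := ExpFamily.exists_abs_log_evidence_ratio_le hF hM hΘ hE hθ₀ hm hw hτ hυ hη₀
        hmean hR
      set v := θ₀ - M.transpose.toEuclideanLin η₀
      set a := F.logPartition θ₀ - F.logPartition (M.transpose.toEuclideanLin η₀)
      -- After division by `n`: the Laplace error, the fluctuation of `s`, and the dimension term.
      have hlim : Tendsto (fun n : ℕ => C * (n : ℝ)⁻¹ + R * ‖v‖ * (√n)⁻¹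
          + ((k : ℝ) - l) / 2 * (Real.log n / n)) atTop (𝓝 0) := by
        have h1 : Tendsto (fun n : ℕ => (n : ℝ)⁻¹) atTop (𝓝 0) :=
          tendsto_inv_atTop_nhds_zero_nat
        have h2 : Tendsto (fun n : ℕ => (√(n : ℝ))⁻¹) atTop (𝓝 0) :=
          tendsto_inv_atTop_zero.comp (Real.tendsto_sqrt_atTop.comp tendsto_natCast_atTop_atTop)
        have h3 : Tendsto (fun n : ℕ => Real.log n / n) atTop (𝓝 0) :=
          (Real.isLittleO_log_id_atTop.tendsto_div_nhds_zero).comp tendsto_natCast_atTop_atTop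
        simpa using ((h1.const_mul C).add (h2.const_mul (R * ‖v‖))).add
          (h3.const_mul (((k : ℝ) - l) / 2))
      filter_upwards [hC, hlim.eventually_lt_const hε, eventually_gt_atTop 0] with n hn hsmall hn0
      filter_upwards [hX_pos] with ω hω hS
      have hn0' : (0 : ℝ) < n := Nat.cast_pos.2 hn0
      have hb := hn (fun i => X i ω) hω hS
      set Q := Real.log (F.evidence τ m n (fun i => X i ω)
        / (F.nested M).evidence υ w n (fun i => X i ω))
      set s := ∑ i ∈ Finset.range n, F.T (X i ω)
      have hs : ∑ i ∈ Finset.range n, (F.T (X i ω) - F.mean θ₀) = s - (n : ℝ) • F.mean θ₀ := by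
        simp [s, Finset.sum_sub_distrib, Nat.cast_smul_eq_nsmul]
      rw [hs] at hS
      have hinner : |inner ℝ (s - (n : ℝ) • F.mean θ₀) v| ≤ R * √n * ‖v‖ :=
        (abs_real_inner_le_norm _ _).trans (by gcongr)
      have hlog : 0 ≤ ((k : ℝ) - l) / 2 * Real.log n := by
        have : (l : ℝ) < k := Nat.cast_lt.2 hlk
        exact mul_nonneg (by linarith) (Real.log_natCast_nonneg n)
      have hsplit : (n : ℝ)⁻¹ * Q - (inner ℝ v (F.mean θ₀) - a) = (n : ℝ)⁻¹ *
          ((Q - (inner ℝ s v - n * a) + ((k : ℝ) - l) / 2 * Real.log n)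
            + inner ℝ (s - (n : ℝ) • F.mean θ₀) v - ((k : ℝ) - l) / 2 * Real.log n) := by
        rw [inner_sub_left s, real_inner_smul_left, real_inner_comm v (F.mean θ₀)]
        field_simp
        ring
      have hbound : |(Q - (inner ℝ s v - n * a) + ((k : ℝ) - l) / 2 * Real.log n)
            + inner ℝ (s - (n : ℝ) • F.mean θ₀) v - ((k : ℝ) - l) / 2 * Real.log n| ≤
          C + R * √n * ‖v‖ + ((k : ℝ) - l) / 2 * Real.log n := by
        have h1 := abs_le.1 hb
        have h2 := abs_le.1 hinner
        rw [abs_le]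
        constructor <;> linarith [h1.1, h1.2, h2.1, h2.2]
      rw [hsplit, abs_mul, abs_of_pos (inv_pos.2 hn0')]
      refine lt_of_le_of_lt (mul_le_mul_of_nonneg_left hbound (inv_pos.2 hn0').le) ?_
      refine lt_of_eq_of_lt ?_ hsmall
      have hsq : (n : ℝ)⁻¹ * √n = (√n)⁻¹ := by
        rw [inv_mul_eq_div, Real.sqrt_div_self', one_div]
      calc _ = C * (n : ℝ)⁻¹ + R * ‖v‖ * ((n : ℝ)⁻¹ * √n)
            + ((k : ℝ) - l) / 2 * (Real.log n / n) := by ring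
        _ = _ := by rw [hsq]
    · rw [ExpFamily.naturalSpace_nested] at hη₀
      have hne : M.transpose.toEuclideanLin η₀ ≠ θ₀ := fun h =>
        hnot ⟨η₀, by rw [ExpFamily.naturalSpace_nested]; exact hη₀, h⟩
      -- The limit is the divergence of the submodel point `Mᵀ η₀` from `θ₀`.
      have h := ExpFamily.divergence_pos hF hΘ hθ₀ hη₀ hne
      rw [ExpFamily.divergence, ← neg_sub θ₀, inner_neg_right,
        real_inner_comm (θ₀ - _)] at h
      linarith
  -- Here `θ₀` is itself `Mᵀ η₀`: the means match automatically, and the terms in `s` and `n` cancel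
  -- identically.
  · obtain ⟨η₀, hη₀, rfl⟩ := hmem
    refine tendstoInMeasure_const_of_tight hX_tight fun R hR ε hε => ?_
    obtain ⟨C, hC⟩ := ExpFamily.exists_abs_log_evidence_ratio_le hF hM hΘ hE hθ₀ hm hw hτ hυ hη₀
      (ExpFamily.mean_nested hΘ hη₀) hR
    have hlog : Tendsto (fun n : ℕ => Real.log n) atTop atTop :=
      Real.tendsto_log_atTop.comp tendsto_natCast_atTop_atTop
    have hlim : Tendsto (fun n : ℕ => C / Real.log n) atTop (𝓝 0) :=
      tendsto_const_nhds.div_atTop hlog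
    filter_upwards [hC, hlim.eventually_lt_const hε, hlog.eventually_gt_atTop 0]
      with n hn hsmall hlog0
    filter_upwards [hX_pos] with ω hω hS
    have hb := hn (fun i => X i ω) hω hS
    simp only [sub_self, inner_zero_right, mul_zero, sub_zero] at hb
    refine lt_of_le_of_lt ?_ hsmall
    rw [le_div_iff₀ hlog0, ← abs_of_pos hlog0, ← abs_mul, abs_of_pos hlog0]
    refine le_of_eq_of_le (congrArg _ ?_) hb
    field_simp
    ring
  · have : (l : ℝ) < k := Nat.cast_lt.2 hlk
    linarith
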